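/- Let $M$ be a smooth (Hausdorff) manifold of dimension $n\ge 2$, let $k\ge 3$, and let $\sigma\in\Sigma_k(M)=C^\infty(S^kTM)$ be a smooth symmetric contravariant $k$-tensor field (a symbol of degree $k$). Regard $\sigma_p\in S^kT_pM$ as the homogeneous polynomial $h(\xi)=\sigma_p(\xi,\dots,\xi)$ of degree $k$ on $T_p^*M$. *Regular forms.* Let $W$ be an $n$-dimensional real vector space. For a homogeneous polynomial $h$ of degree $k$ on $W$ and $w\in W\setminus 0$ put $\Theta_l=\frac{1}{l!}D^lh(w)$, and let $K=\ker\Theta_1\subset W$. A *rational invariant of order $\le 3$* is a rational function $J$ of the coordinates of the 3-jets $j^3_w(h)$ of homogeneous polynomials $h$ of degree $k$ at points $w\ne 0$ which is invariant under $(h,w)\mapsto(h\circ A^{-1},Aw)$, $A\in \mathrm{GL}(W)$; we write $J(h)$ for the rational function $w\mapsto J(j^3_w(h))$ on $W$. The form $h$ is *regular* if there is a point $w\neq 0$ such that (a) $h(w)\ne 0$ and the quadratic form $\Theta_2$ is non-degenerate (then so is its restriction to $K$); (b) the vectors $e,\Phi e,\dots,\Phi^{n-2}e\in K$ are linearly independent,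 where $\lambda\in K^*$ is the contraction of $\Theta_3|_K$ with the inverse of $\Theta_2|_K$, the vector $e\in K$ is defined by $\Theta_2(e,\cdot)=\lambda$ on $K$, and $\Phi:K\to K$ is defined by $\Theta_3(e,X,Y)=\Theta_2(\Phi X,Y)$ for $X,Y\in K$; (c) there are rational invariants $J_1,\dots,J_{n-1},J_n=\Theta_0$ of order $\le 3$ (where $\Theta_0(h)=h$), defined at $j^3_w(h)$, such that $dJ_1(h)\wedge\dots\wedge dJ_n(h)\ne 0$ at $w$. The symbol $\sigma$ is *regular* if the form $\sigma_p$ on $T^*_pM$ is regular for every $p\in M$. It is of *constant type* if there is a $\mathrm{GL}_n(\mathbb R)$-orbit $\varpi\subset S^k\mathbb R^n$ such that $\phi_*\sigma_p\in\varpi$ for every $p\in M$ and every linear isomorphism $\phi:T_pM\to\mathbb R^n$. **Theorem.** Let $k\ge3$, $n\ge2$, and let $\sigma\in\Sigma_k(M)$ be a regular symbol of constant type. Then: 1. There is a unique smooth linear connection $\nabla^\sigma$ on $M$ (that is, on $TM$) such that $\nabla^\sigma_X\sigma=0$ for all vector fields $X$ (the *Wagner connection* of $\sigma$). 2. The Wagner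 connection has zero curvature: $R^\sigma(X,Y)Z=\nabla^\sigma_X\nabla^\sigma_YZ-\nabla^\sigma_Y\nabla^\sigma_XZ-\nabla^\sigma_{[X,Y]}Z=0$ for all smooth vector fields $X,Y,Z$. -/

import Mathlib

open Bundle Manifold
open scoped ContDiff

noncomputable section

namespace WagnerConnection

/-! ### Homogeneous forms, their jets, and regularity -/

section Forms

variable {W : Type*} [NormedAddCommGroup W] [NormedSpace ℝ W]

/-- `h` is a homogeneous form (homogeneous polynomial function) of degree `k` on `W`. -/
def IsForm (k : ℕ) (h : W → ℝ) : Prop :=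
  ∃ T : ContinuousMultilinearMap ℝ (fun _ : Fin k => W) ℝ, ∀ w, h w = T (fun _ => w)

/-- The `l`-th differential `Θ_l = D^l h / l!` of `h` at `w`, as a symmetric `l`-linear form. -/
def Theta (l : ℕ) (h : W → ℝ) (w : W) : ContinuousMultilinearMap ℝ (fun _ : Fin l => W) ℝ :=
  ((l.factorial : ℝ)⁻¹) • iteratedFDeriv ℝ l h w

/-- The kernel of `Θ_1 = dh` at `w`. -/
def kerTheta (h : W → ℝ) (w : W) : Submodule ℝ W :=
  LinearMap.ker (fderiv ℝ h w).toLinearMap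

/-- The 2-jet of `h` at `w` is regular: `h(w) ≠ 0` and `Θ_2` is non-degenerate. -/
def IsRegularJet2 (h : W → ℝ) (w : W) : Prop :=
  h w ≠ 0 ∧ ∀ X : W, (∀ Y : W, Theta 2 h w ![X, Y] = 0) → X = 0

/-- The 3-jet of `h` at `w` is regular: its 2-jet is regular, and the vectors
`e, Φ e, …, Φ^(n-2) e` of `ker Θ_1` are linearly independent (`n = dim W`). Here
`L X` is the operator on `ker Θ_1` with `Θ_2 (L X Y, Z) = Θ_3 (X, Y, Z)`; the 1-form
`λ X = tr (L X)` is the contraction of `Θ_3` with the inverse of `Θ_2` on `ker Θ_1`; the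
vector `e` is dual to `λ` with respect to `Θ_2`; and `Φ = L e`. As `Θ_2` is non-degenerate on
`ker Θ_1` when the 2-jet of a homogeneous form is regular, `L` and `e` exist and are unique. -/
def IsRegularJet3 (h : W → ℝ) (w : W) : Prop :=
  IsRegularJet2 h w ∧
  ∃ (L : kerTheta h w →ₗ[ℝ] kerTheta h w →ₗ[ℝ] kerTheta h w) (e : kerTheta h w),
    (∀ X Y Z : kerTheta h w,
      Theta 2 h w ![(L X Y : W), (Z : W)] = Theta 3 h w ![(X : W), (Y : W), (Z : W)]) ∧
    (∀ X : kerTheta h w,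
      Theta 2 h w ![(e : W), (X : W)] = LinearMap.trace ℝ (kerTheta h w) (L X)) ∧
    LinearIndependent ℝ (fun j : Fin (Module.finrank ℝ W - 1) => ((L e) ^ (j : ℕ)) e)

/-- Indices for the standard coordinates on 3-jets of functions in `n` variables: the coordinates
`x_i` of the base point and the partial derivatives `u_I`, where `I` is an `l`-tuple of indices,
`l ≤ 3`. -/
abbrev JetIndex (n : ℕ) : Type := Fin n ⊕ (Σ l : Fin 4, Fin (l : ℕ) → Fin n)

/-- The coordinates of the 3-jet of `h` at `w` with respect to a basis of `W`. -/
def jetCoord {n : ℕ} (b : Module.Basis (Fin n) ℝ W) (h : W → ℝ) (w : W) : JetIndex n → ℝ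
  | Sum.inl i => b.repr w i
  | Sum.inr ⟨l, I⟩ => iteratedFDeriv ℝ (l : ℕ) h w (fun j => b (I j))

/-- A rational `GL(W)`-invariant of order `≤ 3` of homogeneous forms of degree `k` on `W`: a
quotient of polynomials in the coordinates of the 3-jets of forms at non-zero points, whose
denominator does not vanish identically on these jets and which is invariant under the action
`(h, w) ↦ (h ∘ A⁻¹, A w)` of `A ∈ GL(W)`. -/
structure JetInvariant (k : ℕ) {n : ℕ} (b : Module.Basis (Fin n) ℝ W) where
  num : MvPolynomial (JetIndex n) ℝ
  den : MvPolynomial (JetIndex n) ℝ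
  den_ne : ∃ (g : W → ℝ) (w : W), IsForm k g ∧ w ≠ 0 ∧ den.eval (jetCoord b g w) ≠ 0
  invariant : ∀ (g : W → ℝ) (w : W) (A : W ≃L[ℝ] W), IsForm k g → w ≠ 0 →
    num.eval (jetCoord b (g ∘ A.symm) (A w)) * den.eval (jetCoord b g w) =
      num.eval (jetCoord b g w) * den.eval (jetCoord b (g ∘ A.symm) (A w))

/-- The value `J(h)` of the invariant `J` on `h`, a rational function on `W`. -/
def JetInvariant.value {k n : ℕ} {b : Module.Basis (Fin n) ℝ W} (J : JetInvariant k b)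
    (h : W → ℝ) (w : W) : ℝ :=
  J.num.eval (jetCoord b h w) / J.den.eval (jetCoord b h w)

/-- `J` is the invariant `Θ_0 = u` of order zero. -/
def JetInvariant.IsThetaZero {k n : ℕ} {b : Module.Basis (Fin n) ℝ W} (J : JetInvariant k b) :
    Prop :=
  ∀ (g : W → ℝ) (w : W), IsForm k g → w ≠ 0 →
    J.num.eval (jetCoord b g w) = g w * J.den.eval (jetCoord b g w)

/-- The 4-jet of `h` at `w` is regular: its 3-jet is regular and there are invariants
`J_1, …, J_n = Θ_0` of order `≤ 3`, `n = dim W`, that are defined at this 3-jet and whose total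
differentials are linearly independent at this 4-jet. The value at the 4-jet of `h` of the total
differential of `J` is the differential of the function `J(h)`. -/
def IsRegularJet4 (k : ℕ) (h : W → ℝ) (w : W) : Prop :=
  IsRegularJet3 h w ∧
  ∃ (b : Module.Basis (Fin (Module.finrank ℝ W)) ℝ W)
    (J : Fin (Module.finrank ℝ W) → JetInvariant k b),
    (∀ i : Fin (Module.finrank ℝ W), (i : ℕ) + 1 = Module.finrank ℝ W → (J i).IsThetaZero) ∧
    (∀ i, (J i).den.eval (jetCoord b h w) ≠ 0) ∧
    LinearIndependent ℝ (fun i => fderiv ℝ ((J i).value h) w)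

/-- A homogeneous form `h` of degree `k` on `W` is regular if its 4-jet is regular at some
non-zero point. -/
def IsRegularForm (k : ℕ) (h : W → ℝ) : Prop :=
  IsForm k h ∧ ∃ w : W, w ≠ 0 ∧ IsRegularJet4 k h w

end Forms

/-! ### Symmetric contravariant tensors -/

section Tensors

variable {V V' : Type*}
  [AddCommGroup V] [Module ℝ V] [TopologicalSpace V]
  [AddCommGroup V'] [Module ℝ V'] [TopologicalSpace V']

/-- Contravariant `k`-tensors on a finite-dimensional space `V`, as `k`-linear functions on `V*`. -/
abbrev Tensor (k : ℕ) (V : Type*) [AddCommGroup V] [Module ℝ V] [TopologicalSpace V] : Type _ :=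
  MultilinearMap ℝ (fun _ : Fin k => V →L[ℝ] ℝ) ℝ

/-- `τ` is symmetric, i.e. `τ ∈ S^k V`. -/
def IsSymm {k : ℕ} (τ : Tensor k V) : Prop :=
  ∀ (s : Equiv.Perm (Fin k)) (ξ : Fin k → (V →L[ℝ] ℝ)), τ (fun i => ξ (s i)) = τ ξ

/-- The transpose `ξ ↦ ξ ∘ φ` of a linear isomorphism `φ`. -/
def transpose (φ : V ≃L[ℝ] V') : (V' →L[ℝ] ℝ) →ₗ[ℝ] (V →L[ℝ] ℝ) where
  toFun ξ := ξ.comp (φ : V →L[ℝ] V')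
  map_add' _ _ := rfl
  map_smul' _ _ := rfl

/-- The image `φ_* τ` of a contravariant tensor under a linear isomorphism `φ`. -/
def pushforward {k : ℕ} (φ : V ≃L[ℝ] V') (τ : Tensor k V) : Tensor k V' :=
  τ.compLinearMap (fun _ => transpose φ)

/-- The `GL(V)`-orbit of a contravariant tensor. -/
def glOrbit {k : ℕ} (τ : Tensor k V) : Set (Tensor k V) :=
  Set.range (fun A : V ≃L[ℝ] V => pushforward A τ)

/-- The homogeneous form `ξ ↦ τ(ξ, …, ξ)` on `V*` that corresponds to `τ ∈ S^k V`. -/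
def toForm {k : ℕ} (τ : Tensor k V) : (V →L[ℝ] ℝ) → ℝ := fun ξ => τ (fun _ => ξ)

end Tensors

/-! ### Symbols and connections on a manifold -/

section Manifold

/-- The model space `ℝ^n`. -/
abbrev Model (n : ℕ) : Type := EuclideanSpace ℝ (Fin n)

variable {n : ℕ} {M : Type*} [TopologicalSpace M] [ChartedSpace (Model n) M]
  [IsManifold (𝓡 n) ∞ M]

/-- Smooth differential 1-forms on `M`. -/
structure OneForm (n : ℕ) (M : Type*) [TopologicalSpace M] [ChartedSpace (Model n) M]
    [IsManifold (𝓡 n) ∞ M] where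
  toFun : ∀ p : M, TangentSpace (𝓡 n) p →L[ℝ] ℝ
  smooth : ContMDiff (𝓡 n) ((𝓡 n).prod 𝓘(ℝ, Model n →L[ℝ] ℝ)) ∞
    (fun p => TotalSpace.mk' (Model n →L[ℝ] ℝ)
      (E := fun p : M => TangentSpace (𝓡 n) p →L[ℝ] ℝ) p (toFun p))

/-- Symbols of degree `k`, i.e. smooth sections of `S^k(TM)`. Smoothness means that the value
on any smooth 1-forms is a smooth function. -/
structure Symbol (k n : ℕ) (M : Type*) [TopologicalSpace M] [ChartedSpace (Model n) M]
    [IsManifold (𝓡 n) ∞ M] where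
  toFun : ∀ p : M, Tensor k (TangentSpace (𝓡 n) p)
  symm : ∀ p, IsSymm (toFun p)
  smooth : ∀ θ : Fin k → OneForm n M,
    ContMDiff (𝓡 n) 𝓘(ℝ, ℝ) ∞ (fun p => toFun p (fun i => (θ i).toFun p))

/-- `σ` is regular at every point: the corresponding homogeneous form on the cotangent space,
read through any linear isomorphism of the tangent space with `ℝ^n`, is regular. -/
def Symbol.IsRegular {k : ℕ} (σ : Symbol k n M) : Prop :=
  ∀ (p : M) (φ : TangentSpace (𝓡 n) p ≃L[ℝ] Model n),
    IsRegularForm k (toForm (pushforward φ (σ.toFun p)))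

/-- `σ` has constant type: there is one `GL`-orbit `ϖ ⊂ S^k(ℝ^n)` with `φ_* σ_p ∈ ϖ` for all
points `p` and all linear isomorphisms `φ : T_pM → ℝ^n`. -/
def Symbol.IsConstantType {k : ℕ} (σ : Symbol k n M) : Prop :=
  ∃ τ : Tensor k (Model n), IsSymm τ ∧
    ∀ (p : M) (φ : TangentSpace (𝓡 n) p ≃L[ℝ] Model n), pushforward φ (σ.toFun p) ∈ glOrbit τ

/-- Covariant derivatives on `TM`; here `D Y p X` is `(∇_X Y)(p)`. -/
abbrev Connection (n : ℕ) (M : Type*) [TopologicalSpace M] [ChartedSpace (Model n) M]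
    [IsManifold (𝓡 n) ∞ M] : Type _ :=
  CovariantDerivative (𝓡 n) (Model n) (TangentSpace (𝓡 n) : M → Type _)

/-- `Y` is differentiable at `p`. -/
abbrev DiffAt (Y : ∀ p : M, TangentSpace (𝓡 n) p) (p : M) : Prop :=
  MDifferentiableAt (𝓡 n) ((𝓡 n).prod 𝓘(ℝ, Model n))
    (fun q => TotalSpace.mk' (Model n) (E := (TangentSpace (𝓡 n) : M → Type _)) q (Y q)) p

/-- `Y` is a smooth vector field. -/
abbrev SmoothField (Y : ∀ p : M, TangentSpace (𝓡 n) p) : Prop :=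
  ContMDiff (𝓡 n) ((𝓡 n).prod 𝓘(ℝ, Model n)) ∞
    (fun q => TotalSpace.mk' (Model n) (E := (TangentSpace (𝓡 n) : M → Type _)) q (Y q))

/-- The expression `X(θ(Y)) - θ(∇_X Y)` at the point `p`. -/
def dualDerivAux (D : Connection n M) (θ : OneForm n M) (p : M) (X : TangentSpace (𝓡 n) p)
    (Y : ∀ p : M, TangentSpace (𝓡 n) p) : ℝ :=
  mvfderiv (𝓡 n) (fun q => θ.toFun q (Y q)) p X - θ.toFun p (D.toFun Y p X)

theorem mdifferentiableAt_pairing (θ : OneForm n M) {p : M}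
    {Y : ∀ p : M, TangentSpace (𝓡 n) p} (hY : DiffAt Y p) :
    MDifferentiableAt (𝓡 n) 𝓘(ℝ, ℝ) (fun q => θ.toFun q (Y q)) p := by
  have h := ((θ.smooth p).mdifferentiableAt (by simp)).clm_bundle_apply
    (E₂ := Bundle.Trivial M ℝ) hY
  rw [mdifferentiableAt_totalSpace] at h
  exact h.2

theorem dualDerivAux_tensorial (D : Connection n M) (θ : OneForm n M) (p : M)
    (X : TangentSpace (𝓡 n) p) :
    TensorialAt (𝓡 n) (Model n) (dualDerivAux D θ p X) p where
  smul {f Y} hf hY := by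
    have h1 := mdifferentiableAt_pairing θ hY
    have h2 : mvfderiv (𝓡 n) (fun q => θ.toFun q ((f • Y) q)) p =
        f p • mvfderiv (𝓡 n) (fun q => θ.toFun q (Y q)) p +
          (θ.toFun p (Y p)) • mvfderiv (𝓡 n) f p := by
      rw [← mvfderiv_fun_mul hf h1]
      simp
    simp only [dualDerivAux, h2, D.isCovariantDerivativeOnUniv.leibniz hY hf]
    simp
    ring
  add {Y Y'} hY hY' := by
    have h2 : mvfderiv (𝓡 n) (fun q => θ.toFun q ((Y + Y') q)) p =
        mvfderiv (𝓡 n) (fun q => θ.toFun q (Y q)) p +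
          mvfderiv (𝓡 n) (fun q => θ.toFun q (Y' q)) p := by
      rw [← mvfderiv_fun_add (mdifferentiableAt_pairing θ hY) (mdifferentiableAt_pairing θ hY')]
      simp
    simp only [dualDerivAux, h2, D.isCovariantDerivativeOnUniv.add hY hY']
    simp
    ring

/-- The 1-form `∇_X θ` at the point `p`, given by `(∇_X θ)(Y) = X(θ(Y)) - θ(∇_X Y)`. -/
def dualDeriv (D : Connection n M) (θ : OneForm n M) (p : M) (X : TangentSpace (𝓡 n) p) :
    TangentSpace (𝓡 n) p →L[ℝ] ℝ :=
  TensorialAt.mkHom (dualDerivAux D θ p X) p (dualDerivAux_tensorial D θ p X)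

/-- The covariant derivative of a symbol:
`(∇_X σ)(θ_1, …, θ_k) = X(σ(θ_1, …, θ_k)) - ∑_i σ(θ_1, …, ∇_X θ_i, …, θ_k)` at the point `p`. -/
def symbolDeriv {k : ℕ} (D : Connection n M) (σ : Symbol k n M) (θ : Fin k → OneForm n M)
    (p : M) (X : TangentSpace (𝓡 n) p) : ℝ :=
  mvfderiv (𝓡 n) (fun q => σ.toFun q (fun i => (θ i).toFun q)) p X -
    ∑ i, σ.toFun p (Function.update (fun j => (θ j).toFun p) i (dualDeriv D (θ i) p X))

/-- `D` is a Wagner connection for `σ`: a smooth linear connection with `∇σ = 0`. -/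
def IsWagner {k : ℕ} (σ : Symbol k n M) (D : Connection n M) : Prop :=
  ContMDiffCovariantDerivativeOn (Model n) ∞ D.toFun Set.univ ∧
  ∀ (θ : Fin k → OneForm n M) (p : M) (X : TangentSpace (𝓡 n) p), symbolDeriv D σ θ p X = 0

/-- The curvature `R(X, Y)Z = ∇_X ∇_Y Z - ∇_Y ∇_X Z - ∇_[X,Y] Z`. -/
def curvature (D : Connection n M) (X Y Z : ∀ p : M, TangentSpace (𝓡 n) p) (p : M) :
    TangentSpace (𝓡 n) p :=
  D.toFun (fun q => D.toFun Z q (Y q)) p (X p) - D.toFun (fun q => D.toFun Z q (X q)) p (Y p) -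
    D.toFun Z p (VectorField.mlieBracket (𝓡 n) X Y p)

end Manifold

end WagnerConnection

end

/-! The symbol admits, near every point, a smooth coframe in which its components are constant. The
connection with this coframe parallel preserves the symbol and is flat, so everything reduces to
such coframes and to uniqueness.

Uniqueness is pointwise. Two covariant derivatives that preserve `σ` differ, in a direction `X`, by
an endomorphism `N` of the tangent space that is an infinitesimal symmetry of `σ`. On the cotangent
space the form `h` is preserved by the flow `exp (t N)`, so the invariants `J_i(h)` are constant
along it and `dJ_i(h)` kills `N w`. Where the `n` differentials are independent, `N w = 0`. Such
points form a nonempty open set, which contains a basis, so `N = 0`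
(`eq_zero_of_infinitesimal_symmetry`).

For the coframes, choose a basis `w_i` of points where the differentials of the invariants of `h₀ =
σ_{p₀}` are independent. For a form with coefficients `s` near those of `h₀`, the implicit function
theorem gives a unique point `ψ_i(s)` near `w_i` at which the invariants take the values they have
for `h₀` at `w_i`. If the form is equivalent to `h₀` through `A`, then `A⁻¹ ψ_i(s)` is an isolated
point of a level set of the invariants of `h₀`, in the sense of `countable_isolated_levels`, and
there are only countably many of these. No control on the choice of `A` is needed: the components of
the form in the coframe `ψ(s)` are those of `h₀` on the vectors `A⁻¹ ψ_i(s)`, hence lie in a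
countable set (`exists_coframe_family`). For a symbol of constant type these components are
continuous in the base point, and a continuous map from a connected set to a countable one is
constant (`Symbol.exists_isAdapted`).

By uniqueness the local frame connections agree where they overlap and form one global smooth
connection. In an adapted frame its curvature is the failure of `[X, Y]` to be the commutator of
derivations, which is zero. -/

open Filter Topology

namespace WagnerConnection

/-! ### Joint analyticity of jets and invariants in the coefficients and the point. -/

section FormFamily

variable {W : Type*} [NormedAddCommGroup W] [NormedSpace ℝ W] {ι : Type*} [Fintype ι]

/-- The homogeneous form with coefficients `s` in the basis `β`. -/
noncomputable def formOf {k : ℕ} (β : Module.Basis ι ℝ W) (s : (Fin k → ι) → ℝ) (w : W) : ℝ :=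
  ∑ I, s I * ∏ j, β.repr w (I j)

theorem multilinear_apply_eq_sum {k : ℕ} (β : Module.Basis ι ℝ W)
    (T : MultilinearMap ℝ (fun _ : Fin k => W) ℝ) (v : Fin k → W) :
    T v = ∑ I : Fin k → ι, T (fun j => β (I j)) * ∏ j, β.repr (v j) (I j) := by
  classical
  conv_lhs => rw [show v = fun j => ∑ i, β.repr (v j) i • β i from
    funext fun j => (β.sum_repr (v j)).symm]
  rw [MultilinearMap.map_sum]
  refine Finset.sum_congr rfl fun I _ => ?_
  rw [MultilinearMap.map_smul_univ, smul_eq_mul, mul_comm]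

theorem formOf_coeff {k : ℕ} (β : Module.Basis ι ℝ W)
    (T : MultilinearMap ℝ (fun _ : Fin k => W) ℝ) :
    formOf β (fun I => T (fun j => β (I j))) = fun w => T (fun _ => w) := by
  ext w
  rw [multilinear_apply_eq_sum β T, formOf]

omit [Fintype ι] in
theorem contDiff_basis_repr [FiniteDimensional ℝ W] {m : WithTop ℕ∞} (β : Module.Basis ι ℝ W)
    (i : ι) : ContDiff ℝ m (fun w : W => β.repr w i) :=
  (LinearMap.toContinuousLinearMap (β.coord i)).contDiff

theorem contDiff_formOf [FiniteDimensional ℝ W] {k : ℕ} {m : WithTop ℕ∞}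
    (β : Module.Basis ι ℝ W) :
    ContDiff ℝ m (fun q : ((Fin k → ι) → ℝ) × W => formOf β q.1 q.2) := by
  unfold formOf
  refine ContDiff.sum fun I _ => ContDiff.mul ?_ ?_
  · exact (contDiff_apply ℝ ℝ I).comp contDiff_fst
  · exact contDiff_prod fun j _ => (contDiff_basis_repr β (I j)).comp contDiff_snd

/-- The slice `w ↦ (s, w)` is a translate of a linear inclusion, so derivatives along `W` are
partial derivatives of one jointly analytic function. This makes jets depend analytically on
coefficients and point together, as the implicit function theorem requires. -/
theorem iteratedFDeriv_formOf [FiniteDimensional ℝ W] {k : ℕ} (β : Module.Basis ι ℝ W) (l : ℕ)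
    (s : (Fin k → ι) → ℝ) (w : W) (v : Fin l → W) :
    iteratedFDeriv ℝ l (formOf β s) w v =
      iteratedFDeriv ℝ l (fun q : ((Fin k → ι) → ℝ) × W => formOf β q.1 q.2) (s, w)
        (fun j => (0, v j)) := by
  set H := fun q : ((Fin k → ι) → ℝ) × W => formOf β q.1 q.2 with hH
  have hs : ContDiff ℝ ω (fun q => H ((s, 0) + q)) :=
    (contDiff_formOf β).comp (contDiff_const.add contDiff_id)
  have e : formOf β s =
      (fun q => H ((s, 0) + q)) ∘ (ContinuousLinearMap.inr ℝ ((Fin k → ι) → ℝ) W) := by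
    ext w
    simp [hH]
  rw [e, ContinuousLinearMap.iteratedFDeriv_comp_right _ hs w (by simp),
    iteratedFDeriv_comp_add_left]
  simp

theorem contDiff_jetCoord [FiniteDimensional ℝ W] {k n : ℕ} (β : Module.Basis ι ℝ W)
    (b : Module.Basis (Fin n) ℝ W) (j : JetIndex n) :
    ContDiff ℝ ω (fun q : ((Fin k → ι) → ℝ) × W => jetCoord b (formOf β q.1) q.2 j) := by
  rcases j with i | ⟨l, I⟩
  · exact (contDiff_basis_repr b i).comp contDiff_snd
  · simp only [jetCoord, iteratedFDeriv_formOf]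
    have h : ContDiff ℝ ω (iteratedFDeriv ℝ (l : ℕ)
        (fun q : ((Fin k → ι) → ℝ) × W => formOf β q.1 q.2)) :=
      (contDiff_formOf (m := ω) β).iteratedFDeriv_right (by simp)
    exact (ContinuousMultilinearMap.apply ℝ _ ℝ _).contDiff.comp h

theorem contDiff_mvPolynomial_eval {E κ : Type*} [NormedAddCommGroup E] [NormedSpace ℝ E]
    {m : WithTop ℕ∞} (p : MvPolynomial κ ℝ) {f : E → κ → ℝ}
    (hf : ∀ j, ContDiff ℝ m (fun x => f x j)) : ContDiff ℝ m (fun x => p.eval (f x)) := by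
  simp only [MvPolynomial.eval_eq]
  exact ContDiff.sum fun d _ => contDiff_const.mul (contDiff_prod fun i _ => (hf i).pow _)

theorem contDiff_eval_jetCoord [FiniteDimensional ℝ W] {k n : ℕ} (β : Module.Basis ι ℝ W)
    (b : Module.Basis (Fin n) ℝ W) (p : MvPolynomial (JetIndex n) ℝ) :
    ContDiff ℝ ω (fun q : ((Fin k → ι) → ℝ) × W => p.eval (jetCoord b (formOf β q.1) q.2)) :=
  contDiff_mvPolynomial_eval p (contDiff_jetCoord β b)

theorem contDiff_eval_jetCoord_right [FiniteDimensional ℝ W] {k n : ℕ} (β : Module.Basis ι ℝ W)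
    (b : Module.Basis (Fin n) ℝ W) (p : MvPolynomial (JetIndex n) ℝ) (s : (Fin k → ι) → ℝ) :
    ContDiff ℝ ω (fun w : W => p.eval (jetCoord b (formOf β s) w)) :=
  contDiff_mvPolynomial_eval p fun j =>
    ContDiff.comp (g := fun q : ((Fin k → ι) → ℝ) × W => jetCoord b (formOf β q.1) q.2 j)
      (f := fun w : W => (s, w)) (contDiff_jetCoord β b j) (by fun_prop)

theorem contDiffAt_value [FiniteDimensional ℝ W] {k n : ℕ} (β : Module.Basis ι ℝ W)
    {b : Module.Basis (Fin n) ℝ W} (J : JetInvariant k b) {s : (Fin k → ι) → ℝ} {w : W}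
    (h : J.den.eval (jetCoord b (formOf β s) w) ≠ 0) :
    ContDiffAt ℝ ω (fun q : ((Fin k → ι) → ℝ) × W => J.value (formOf β q.1) q.2) (s, w) :=
  (contDiff_eval_jetCoord β b J.num).contDiffAt.div (contDiff_eval_jetCoord β b J.den).contDiffAt h

theorem contDiffAt_value_right [FiniteDimensional ℝ W] {k n : ℕ} (β : Module.Basis ι ℝ W)
    {b : Module.Basis (Fin n) ℝ W} (J : JetInvariant k b) {s : (Fin k → ι) → ℝ} {w : W}
    (h : J.den.eval (jetCoord b (formOf β s) w) ≠ 0) :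
    ContDiffAt ℝ ω (J.value (formOf β s)) w :=
  (contDiff_eval_jetCoord_right β b J.num s).contDiffAt.div
    (contDiff_eval_jetCoord_right β b J.den s).contDiffAt h

/-- The locus where all invariants of a family are defined is dense as soon as it contains a
point. -/
theorem dense_den_ne_zero [FiniteDimensional ℝ W] {k n : ℕ} {κ : Type*} [Finite κ]
    (β : Module.Basis ι ℝ W) {b : Module.Basis (Fin n) ℝ W} (J : κ → JetInvariant k b)
    {s : (Fin k → ι) → ℝ} {w : W} (h : ∀ i, (J i).den.eval (jetCoord b (formOf β s) w) ≠ 0) :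
    Dense {v : W | ∀ i, (J i).den.eval (jetCoord b (formOf β s) v) ≠ 0} := by
  rw [Set.ofPred_forall]
  refine dense_iInter_of_isOpen (fun i => ?_) fun i => ?_
  · exact isOpen_ne_fun (contDiff_eval_jetCoord_right β b (J i).den s).continuous continuous_const
  · intro v
    rw [mem_closure_iff_frequently]
    intro hv
    -- By the identity theorem a denominator that vanishes near `v` would vanish everywhere, in
    -- particular at `w`.
    have ha : AnalyticOnNhd ℝ (fun v : W => (J i).den.eval (jetCoord b (formOf β s) v)) Set.univ :=
      (contDiff_eval_jetCoord_right β b (J i).den s).analyticOnNhd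
    exact h i (ha.eqOn_zero_of_preconnected_of_eventuallyEq_zero isPreconnected_univ
      (Set.mem_univ v) (hv.mono fun x hx => not_not.1 hx) (Set.mem_univ w))

end FormFamily

/-- `n` linearly independent functionals on an `n`-dimensional space separate points. -/
theorem eq_zero_of_linearIndependent_dual {W : Type*} [NormedAddCommGroup W] [NormedSpace ℝ W]
    [FiniteDimensional ℝ W] {f : Fin (Module.finrank ℝ W) → (W →L[ℝ] ℝ)}
    (hf : LinearIndependent ℝ f) {v : W} (hv : ∀ i, f i v = 0) : v = 0 := by
  let g : Fin (Module.finrank ℝ W) → Module.Dual ℝ W := fun i => (f i : W →ₗ[ℝ] ℝ)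
  have hg : LinearIndependent ℝ g :=
    hf.map' (ContinuousLinearMap.coeLM ℝ) (LinearMap.ker_eq_bot.2
      ContinuousLinearMap.coe_injective)
  have hs := hg.span_eq_top_of_card_eq_finrank' (by simp)
  rw [← Module.forall_dual_apply_eq_zero_iff ℝ]
  intro φ
  have hφ : φ ∈ Submodule.span ℝ (Set.range g) := hs ▸ Submodule.mem_top
  induction hφ using Submodule.span_induction with
  | mem x hx => obtain ⟨i, rfl⟩ := hx; exact hv i
  | zero => rfl
  | add x y _ _ hx hy => simp [hx, hy]
  | smul a x _ hx => simp [hx]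

/-- A nonempty open set spans affinely, hence linearly, so it contains a basis. -/
theorem exists_linearIndependent_of_isOpen {W : Type*} [NormedAddCommGroup W] [NormedSpace ℝ W]
    [FiniteDimensional ℝ W] {n : ℕ} (hn : Module.finrank ℝ W = n) {U : Set W} (hU : IsOpen U)
    (hne : U.Nonempty) : ∃ w : Fin n → W, LinearIndependent ℝ w ∧ ∀ i, w i ∈ U := by
  have hspan : Submodule.span ℝ U = ⊤ := by
    have h := affineSpan_le_toAffineSubspace_span (k := ℝ) (s := U)
    rw [hU.affineSpan_eq_top hne, top_le_iff] at h
    rw [eq_top_iff]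
    intro x _
    have : x ∈ (⊤ : AffineSubspace ℝ W) := AffineSubspace.mem_top ℝ W x
    rw [← h] at this
    simpa using this
  obtain ⟨B, hBU, hB, hli⟩ := exists_linearIndependent ℝ U
  rw [hspan] at hB
  let bs := Module.Basis.mk hli (by rw [Subtype.range_coe, hB])
  have : Fintype B := FiniteDimensional.fintypeBasisIndex bs
  have hcard : Fintype.card B = n := by rw [← Module.finrank_eq_card_basis bs, hn]
  let e : Fin n ≃ B := (Fintype.equivFinOfCardEq hcard).symm
  exact ⟨fun i => e i, hli.comp e e.injective, fun i => hBU (e i).2⟩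

/-! ### Points singled out by the values of the invariants. -/

section RigidPoints

/-- Points at which some continuous extension of `R|_D` takes the value `c` in an isolated way
form a countable set, when `D` is dense. -/
theorem countable_isolated_levels {W Z : Type*} [TopologicalSpace W] [SecondCountableTopology W]
    [TopologicalSpace Z] [T2Space Z] (R : W → Z) {D : Set W} (hD : Dense D) (c : Z) :
    {u : W | ∃ G : W → Z, ∀ᶠ v in 𝓝 u, ContinuousAt G v ∧ (v ∈ D → G v = R v) ∧
      (G v = c ↔ v = u)}.Countable := by
  set C := {u : W | ∃ G : W → Z, ∀ᶠ v in 𝓝 u, ContinuousAt G v ∧ (v ∈ D → G v = R v) ∧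
      (G v = c ↔ v = u)} with hC
  -- In a second countable space a discrete subset is countable, so it suffices to separate each
  -- point of `C` from the others.
  refine (HereditarilyLindelofSpace.isLindelof C).countable_of_isDiscrete ?_
  rw [isDiscrete_iff_forall_mem_exists_isOpen]
  rintro u ⟨G, hG⟩
  obtain ⟨O, hO, hOo, huO⟩ := eventually_nhds_iff.1 hG
  refine ⟨O, hOo, ?_⟩
  ext u'
  constructor
  · rintro ⟨hu'O, G', hG'⟩
    have h' := hG'.self_of_nhds
    -- Two extensions of `R|_D` that are continuous at `u'` agree there: otherwise they would differ
    -- near `u'`, also at points of the dense set `D`, where both equal `R`. So `G` also takes the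
    -- value `c` at `u'`, which forces `u' = u`.
    have : G u' = G' u' := by
      by_contra hne
      have h1 : ∀ᶠ v in 𝓝 u', G v ≠ G' v := ((hO u' hu'O).1.ne_iff_eventually_ne h'.1).1 hne
      obtain ⟨v, hv4, hv1, hv2, hv3⟩ :=
        hD.inter_nhds_nonempty (h1.and (hG'.and (hOo.mem_nhds hu'O)))
      exact hv1 (((hO v hv3).2.1 hv4).trans (hv2.2.1 hv4).symm)
    exact ((hO u' hu'O).2.2).1 (this.trans (h'.2.2.2 rfl))
  · rintro rfl
    exact ⟨huO, G, hG⟩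

variable {W : Type*} [NormedAddCommGroup W] [NormedSpace ℝ W] [FiniteDimensional ℝ W]

/-- `J` is a family of invariants that are defined at the 3-jet of `h` at `w` and have
independent differentials there. -/
def IsGoodPoint {k : ℕ} {b : Module.Basis (Fin (Module.finrank ℝ W)) ℝ W}
    (J : Fin (Module.finrank ℝ W) → JetInvariant k b) (h : W → ℝ) (w : W) : Prop :=
  w ≠ 0 ∧ (∀ i, (J i).den.eval (jetCoord b h w) ≠ 0) ∧
    LinearIndependent ℝ (fun i => fderiv ℝ ((J i).value h) w)

/-- Non-vanishing of the denominators and linear independence of continuously varying differentials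
are open conditions. -/
theorem isOpen_isGoodPoint {ι : Type*} [Fintype ι] {k : ℕ} (β : Module.Basis ι ℝ W)
    {b : Module.Basis (Fin (Module.finrank ℝ W)) ℝ W}
    (J : Fin (Module.finrank ℝ W) → JetInvariant k b) (s : (Fin k → ι) → ℝ) :
    IsOpen {w | IsGoodPoint J (formOf β s) w} := by
  rw [isOpen_iff_mem_nhds]
  rintro w ⟨h0, hd, hl⟩
  have h1 : ∀ᶠ v in 𝓝 w, ∀ i, (J i).den.eval (jetCoord b (formOf β s) v) ≠ 0 :=
    eventually_all.2 fun i =>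
      (contDiff_eval_jetCoord_right β b (J i).den s).continuous.continuousAt.eventually_ne (hd i)
  have hc : ContinuousAt (fun v => fun i => fderiv ℝ ((J i).value (formOf β s)) v) w :=
    continuousAt_pi.2 fun i =>
      ((contDiffAt_value_right β (J i) (hd i)).fderiv_right (m := ω) (by simp)).continuousAt
  have h2 := hc.eventually (hl.eventually)
  filter_upwards [h1, h2, isOpen_ne.mem_nhds h0] with v a1 a2 a3 using ⟨a3, a1, a2⟩

omit [FiniteDimensional ℝ W] in
theorem exists_isGoodPoint {k : ℕ} {h : W → ℝ} (hh : IsRegularForm k h) :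
    ∃ (b : Module.Basis (Fin (Module.finrank ℝ W)) ℝ W)
      (J : Fin (Module.finrank ℝ W) → JetInvariant k b) (w : W), IsGoodPoint J h w := by
  obtain ⟨-, w, hw, -, b, J, -, hd, hl⟩ := hh
  exact ⟨b, J, w, hw, hd, hl⟩

/-- Around a good point `w` of `h₀`, the points of other forms `h` that have the same values of
invariants form a smooth family `ψ`, and equivalences of `h` with `h₀` can take `ψ` only
to a countable set. -/
theorem exists_implicit_point {ι : Type*} [Fintype ι] {k : ℕ} (β : Module.Basis ι ℝ W)
    {b : Module.Basis (Fin (Module.finrank ℝ W)) ℝ W}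
    (J : Fin (Module.finrank ℝ W) → JetInvariant k b) (s₀ : (Fin k → ι) → ℝ) {w : W}
    (hform : IsForm k (formOf β s₀)) (hw : IsGoodPoint J (formOf β s₀) w) :
    ∃ (ψ : ((Fin k → ι) → ℝ) → W) (C : Set W), ψ s₀ = w ∧ C.Countable ∧
      (∀ᶠ s in 𝓝 s₀, ContDiffAt ℝ ∞ ψ s) ∧
      ∀ᶠ s in 𝓝 s₀, ∀ A : W ≃L[ℝ] W, formOf β s = formOf β s₀ ∘ A.symm → A.symm (ψ s) ∈ C := by
  obtain ⟨h0, hd, hl⟩ := hw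
  let F : (((Fin k → ι) → ℝ) × W) → Fin (Module.finrank ℝ W) → ℝ :=
    fun q i => (J i).value (formOf β q.1) q.2
  have hF : ContDiffAt ℝ ω F (s₀, w) := contDiffAt_pi.2 fun i => contDiffAt_value β (J i) (hd i)
  -- The partial derivative along `W` has the `n` independent differentials as its components, so it
  -- is injective between spaces of equal dimension.
  have hinv : (fderiv ℝ F (s₀, w) ∘L .inr ℝ ((Fin k → ι) → ℝ) W).IsInvertible := by
    have hval : ∀ i v, (fderiv ℝ F (s₀, w) ∘L .inr ℝ ((Fin k → ι) → ℝ) W) v i =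
        fderiv ℝ ((J i).value (formOf β s₀)) w v := by
      intro i v
      have e1 : HasFDerivAt (fun v => F (s₀, v) i)
          ((ContinuousLinearMap.proj i ∘L fderiv ℝ F (s₀, w)) ∘L .inr ℝ ((Fin k → ι) → ℝ) W) w := by
        have e2 : HasFDerivAt (fun q => F q i) (ContinuousLinearMap.proj i ∘L fderiv ℝ F (s₀, w))
            (s₀, w) :=
          (ContinuousLinearMap.proj (R := ℝ) (φ := fun _ : Fin (Module.finrank ℝ W) => ℝ)
            i).hasFDerivAt.comp (s₀, w) (hF.differentiableAt (by simp)).hasFDerivAt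
        exact e2.comp w (hasFDerivAt_prodMk_right s₀ w)
      have e3 := e1.fderiv
      rw [show ((J i).value (formOf β s₀)) = fun v => F (s₀, v) i from rfl, e3]
      rfl
    have hinj : Function.Injective (fderiv ℝ F (s₀, w) ∘L .inr ℝ ((Fin k → ι) → ℝ) W) := by
      rw [injective_iff_map_eq_zero]
      intro v hv
      refine eq_zero_of_linearIndependent_dual hl (v := v) fun i => ?_
      rw [← hval i v, hv]
      rfl
    exact ⟨(LinearEquiv.ofInjectiveOfFinrankEq
      (fderiv ℝ F (s₀, w) ∘L .inr ℝ ((Fin k → ι) → ℝ) W).toLinearMap hinj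
        (by simp)).toContinuousLinearEquiv, by ext v; rfl⟩
  have pn : (ω : WithTop ℕ∞) ≠ 0 := by simp
  set ψ := hF.implicitFunction pn hinv with hψ
  have hψ0 : ψ s₀ = w := hF.implicitFunction_apply_self pn hinv
  have hψC : ContDiffAt ℝ ω ψ s₀ := hF.contDiffAt_implicitFunction pn hinv
  let R : W → Fin (Module.finrank ℝ W) → ℝ := fun u => F (s₀, u)
  refine ⟨ψ, _, hψ0, countable_isolated_levels R (dense_den_ne_zero β J hd) (F (s₀, w)),
    (hψC.eventually (by simp)).mono fun s hs => hs.of_le le_top, ?_⟩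
  have hev : ∀ᶠ q in 𝓝 (s₀, w), (F q = F (s₀, w) ↔ ψ q.1 = q.2) ∧ ContDiffAt ℝ ω F q ∧
      q.2 ≠ 0 ∧ ∀ i, (J i).den.eval (jetCoord b (formOf β q.1) q.2) ≠ 0 := by
    refine (hF.eventually_apply_eq_iff_implicitFunction pn hinv).and
      ((hF.eventually (by simp)).and (.and ?_ (eventually_all.2 fun i => ?_)))
    · exact continuousAt_snd.eventually_ne h0
    · exact (contDiff_eval_jetCoord β b (J i).den).continuous.continuousAt.eventually_ne (hd i)
  have ht : Tendsto (fun s => (s, ψ s)) (𝓝 s₀) (𝓝 (s₀, w)) := by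
    have := continuousAt_id.prodMk hψC.continuousAt
    rw [ContinuousAt, hψ0] at this
    exact this
  -- The conditions are needed on a whole neighbourhood of `(s, ψ s)`, because `A v` has to range
  -- near `ψ s`.
  filter_upwards [ht.eventually hev.eventually_nhds] with s hs A hA
  -- Invariance concerns only the quotient: a denominator may vanish at `A⁻¹ (ψ s)` for `h₀` and yet
  -- not at `ψ s` for the equivalent form. The invariants of the latter, pulled back by `A`,
  -- therefore serve as the continuous extension of those of `h₀`.
  refine ⟨fun v => F (s, A v), ?_⟩
  have hta : Tendsto (fun v => (s, A v)) (𝓝 (A.symm (ψ s))) (𝓝 (s, ψ s)) := by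
    have : ContinuousAt (fun v => (s, A v)) (A.symm (ψ s)) := by fun_prop
    simpa [ContinuousAt] using this
  filter_upwards [hta.eventually hs] with v ⟨hv1, hv2, hv3, hv4⟩
  refine ⟨?_, fun hvD => ?_, ?_⟩
  · exact ContinuousAt.comp (f := fun v => (s, A v)) hv2.continuousAt (by fun_prop)
  · ext i
    have hv0 : v ≠ 0 := fun h => hv3 (by simp [h])
    have := (J i).invariant (formOf β s₀) v A hform hv0
    rw [← hA] at this
    simp only [F, R, JetInvariant.value]
    rw [div_eq_div_iff (hv4 i) (hvD i)]
    exact this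
  · rw [hv1]
    rw [ContinuousLinearEquiv.eq_symm_apply]
    exact eq_comm

end RigidPoints

/-! ### Infinitesimal symmetries of regular forms and coframes attached to nearby forms. -/

section RegularForms

variable {W : Type*} [NormedAddCommGroup W] [NormedSpace ℝ W] [FiniteDimensional ℝ W]

/-- A multilinear form on a finite-dimensional space, as a continuous multilinear form. -/
noncomputable def toContinuousMultilinear {k : ℕ} (T : MultilinearMap ℝ (fun _ : Fin k => W) ℝ) :
    ContinuousMultilinearMap ℝ (fun _ : Fin k => W) ℝ where
  toMultilinearMap := T
  cont := by
    have h : T.toFun = fun v => ∑ I : Fin k → Fin (Module.finrank ℝ W),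
        T (fun j => Module.finBasis ℝ W (I j)) * ∏ j, (Module.finBasis ℝ W).repr (v j) (I j) :=
      funext fun v => multilinear_apply_eq_sum (Module.finBasis ℝ W) T v
    rw [h]
    refine continuous_finsetSum _ fun I _ => continuous_const.mul
      (continuous_finsetProd _ fun j _ => ?_)
    exact (contDiff_basis_repr (m := 0) (Module.finBasis ℝ W) (I j)).continuous.comp
      (continuous_apply j)

theorem hasFDerivAt_multilinear {k : ℕ} (T : MultilinearMap ℝ (fun _ : Fin k => W) ℝ)
    (v : Fin k → W) :
    HasFDerivAt (fun v => T v) ((toContinuousMultilinear T).linearDeriv v) v :=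
  (toContinuousMultilinear T).hasFDerivAt v

open Classical in
theorem linearDeriv_toContinuousMultilinear {k : ℕ} (T : MultilinearMap ℝ (fun _ : Fin k => W) ℝ)
    (v y : Fin k → W) :
    (toContinuousMultilinear T).linearDeriv v y = ∑ i, T (Function.update v i (y i)) := by
  rw [ContinuousMultilinearMap.linearDeriv_apply]
  rfl

omit [FiniteDimensional ℝ W] in
theorem exp_smul_mul_exp_neg_smul [CompleteSpace W] (N : W →L[ℝ] W) (t : ℝ) :
    NormedSpace.exp (t • N) * NormedSpace.exp (-t • N) = 1 := by
  let _ : NormedAlgebra ℚ (W →L[ℝ] W) := NormedAlgebra.restrictScalars ℚ ℝ (W →L[ℝ] W)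
  rw [← NormedSpace.exp_add_of_commute (((Commute.refl N).smul_left _).smul_right _), ← add_smul]
  simp

/-- The family of symmetries `exp (t N)` generated by an endomorphism `N`. -/
noncomputable def expEquiv (N : W →L[ℝ] W) (t : ℝ) : W ≃L[ℝ] W :=
  haveI := FiniteDimensional.complete ℝ W
  ContinuousLinearEquiv.equivOfInverse (NormedSpace.exp (t • N)) (NormedSpace.exp (-t • N))
    (fun w => by
      have h := exp_smul_mul_exp_neg_smul N (-t)
      rw [neg_neg] at h
      exact congrArg (fun f : W →L[ℝ] W => f w) h)
    (fun w => congrArg (fun f : W →L[ℝ] W => f w) (exp_smul_mul_exp_neg_smul N t))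

theorem hasDerivAt_expEquiv (N : W →L[ℝ] W) (w : W) (t : ℝ) :
    HasDerivAt (fun t => expEquiv N t w) (N (expEquiv N t w)) t := by
  have := FiniteDimensional.complete ℝ W
  have h := hasDerivAt_exp_smul_const' (𝕂 := ℝ) N t
  exact (ContinuousLinearMap.apply ℝ W w).hasFDerivAt.comp_hasDerivAt t h

theorem expEquiv_zero (N : W →L[ℝ] W) (w : W) : expEquiv N 0 w = w := by
  change NormedSpace.exp ((0 : ℝ) • N) w = w
  simp

/-- The Lie algebra of the stabilizer of a regular form is trivial. -/
theorem eq_zero_of_infinitesimal_symmetry {k : ℕ} (T : MultilinearMap ℝ (fun _ : Fin k => W) ℝ)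
    (hT : IsRegularForm k (fun w => T (fun _ => w))) (N : W →L[ℝ] W)
    (hN : ∀ v : Fin k → W, ∑ i, T (Function.update v i (N (v i))) = 0) : N = 0 := by
  obtain ⟨b, J, w₀, hw₀⟩ := exists_isGoodPoint hT
  set h : W → ℝ := fun w => T (fun _ => w) with hh
  have hform : h = formOf b (fun I => T (fun j => b (I j))) := (formOf_coeff b T).symm
  -- The derivative of `h` along the flow is the sum in `hN` for a constant tuple.
  have hflow : ∀ w t, h (expEquiv N t w) = h w := by
    intro w t
    have hd : ∀ t, HasDerivAt (fun t => h (expEquiv N t w)) 0 t := by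
      intro t
      have h1 : HasDerivAt (fun t => fun _ : Fin k => expEquiv N t w)
          (fun _ => N (expEquiv N t w)) t := hasDerivAt_pi.2 fun _ => hasDerivAt_expEquiv N w t
      have h2 := (hasFDerivAt_multilinear T (fun _ => expEquiv N t w)).comp_hasDerivAt t h1
      rw [linearDeriv_toContinuousMultilinear, hN] at h2
      exact h2
    have := is_const_of_deriv_eq_zero (fun t => (hd t).differentiableAt) (fun t => (hd t).deriv) t 0
    simpa [expEquiv_zero] using this
  have hinv : ∀ t, h ∘ (expEquiv N t).symm = h := by
    intro t
    ext w
    have := hflow ((expEquiv N t).symm w) t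
    simpa using this.symm
  -- The flow preserves `h`, so `J_i(h)` is constant along the orbit of `w` for small times and its
  -- differential vanishes on the velocity `N w`.
  have hzero : ∀ w, IsGoodPoint J h w → N w = 0 := by
    rintro w ⟨hw0, hd, hl⟩
    refine eq_zero_of_linearIndependent_dual hl fun i => ?_
    have hderiv := hasDerivAt_expEquiv N w 0
    rw [expEquiv_zero] at hderiv
    have hdiff : HasFDerivAt ((J i).value h) (fderiv ℝ ((J i).value h) w) (expEquiv N 0 w) := by
      rw [expEquiv_zero]
      have := hd i
      rw [hform] at this ⊢
      exact ((contDiffAt_value_right b (J i) this).differentiableAt (by simp)).hasFDerivAt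
    have h1 := hdiff.comp_hasDerivAt 0 hderiv
    have hden : ∀ᶠ t in 𝓝 (0 : ℝ), (J i).den.eval (jetCoord b h (expEquiv N t w)) ≠ 0 := by
      have hc : ContinuousAt (fun v => (J i).den.eval (jetCoord b h v)) (expEquiv N 0 w) := by
        rw [hform]
        exact (contDiff_eval_jetCoord_right b b (J i).den _).continuous.continuousAt
      refine (hc.comp (f := fun t => expEquiv N t w)
        (hasDerivAt_expEquiv N w 0).continuousAt).eventually_ne ?_
      simpa [expEquiv_zero] using hd i
    have h2 : (J i).value h ∘ (fun t => expEquiv N t w) =ᶠ[𝓝 0] fun _ => (J i).value h w := by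
      filter_upwards [hden] with t ht
      have := (J i).invariant h w (expEquiv N t) hT.1 hw0
      rw [hinv t] at this
      simp only [Function.comp, JetInvariant.value]
      rw [div_eq_div_iff ht (hd i), this]
    exact h1.unique ((hasDerivAt_const (0 : ℝ) ((J i).value h w)).congr_of_eventuallyEq h2)
  have hopen : IsOpen {w | IsGoodPoint J h w} := by
    rw [hform]
    exact isOpen_isGoodPoint b J _
  obtain ⟨u, hu, huU⟩ := exists_linearIndependent_of_isOpen rfl hopen ⟨w₀, hw₀⟩
  let bu := basisOfLinearIndependentOfCardEqFinrank' u hu (by simp)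
  ext w
  have : (N : W →ₗ[ℝ] W) = 0 := bu.ext fun i => by
    simpa [bu] using hzero _ (huU i)
  exact congrArg (fun f : W →ₗ[ℝ] W => f w) this

/-- Near a regular form `T₀` there is a smooth family of coframes such that the forms equivalent
to `T₀` have, in these coframes, coefficients from a countable set. -/
theorem exists_coframe_family {k n : ℕ} (hn : Module.finrank ℝ W = n)
    (β : Module.Basis (Fin n) ℝ W) (T₀ : MultilinearMap ℝ (fun _ : Fin k => W) ℝ)
    (hT₀ : IsRegularForm k (fun w => T₀ (fun _ => w))) :
    ∃ (ψ : Fin n → ((Fin k → Fin n) → ℝ) → W) (C : Set ((Fin k → Fin n) → ℝ)),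
      LinearIndependent ℝ (fun i => ψ i (fun I => T₀ (fun j => β (I j)))) ∧ C.Countable ∧
      (∀ i, ∀ᶠ s in 𝓝 (fun I => T₀ (fun j => β (I j))), ContDiffAt ℝ ∞ (ψ i) s) ∧
      ∀ᶠ s in 𝓝 (fun I => T₀ (fun j => β (I j))), ∀ A : W ≃L[ℝ] W,
        (∀ I : Fin k → Fin n, T₀ (fun j => A.symm (β (I j))) = s I) →
          (fun I : Fin k → Fin n => T₀ (fun j => A.symm (ψ (I j) s))) ∈ C := by
  obtain ⟨b, J, w₀, hw₀⟩ := exists_isGoodPoint hT₀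
  set s₀ : (Fin k → Fin n) → ℝ := fun I => T₀ (fun j => β (I j)) with hs₀
  have hform : formOf β s₀ = fun w => T₀ (fun _ => w) := formOf_coeff β T₀
  rw [← hform] at hw₀ hT₀
  obtain ⟨u, hu, huU⟩ := exists_linearIndependent_of_isOpen hn (isOpen_isGoodPoint β J s₀) ⟨w₀, hw₀⟩
  choose ψ C h1 h2 h3 h4 using fun i => exists_implicit_point β J s₀ hT₀.1 (huU i)
  -- The possible coefficients are those of `T₀` on tuples whose `i`-th vector lies in the countable
  -- set `C i`.
  refine ⟨ψ, (fun c : Fin n → W => fun I => T₀ (fun j => c (I j))) '' Set.univ.pi C, ?_, ?_, h3, ?_⟩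
  · simpa only [h1] using hu
  · exact (Set.countable_univ_pi h2).image _
  · filter_upwards [eventually_all.2 h4] with s hs A hA
    refine ⟨fun i => A.symm (ψ i s), fun i _ => hs i A ?_, rfl⟩
    have := formOf_coeff β (T₀.compLinearMap fun _ => (A.symm : W →ₗ[ℝ] W))
    rw [hform]
    ext w
    have e : (fun I : Fin k → Fin n => T₀ fun j => A.symm (β (I j))) = s := funext hA
    rw [← e]
    exact congrFun this w

end RegularForms

/-! ### Smooth vector and covector fields in charts. -/

section Manifold

variable {n : ℕ} {M : Type*} [TopologicalSpace M] [ChartedSpace (Model n) M]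
  [IsManifold (𝓡 n) ∞ M]

/-- The field of covectors `θ` is smooth at `p`. -/
abbrev SmoothCovectorAt (θ : ∀ p : M, TangentSpace (𝓡 n) p →L[ℝ] ℝ) (p : M) : Prop :=
  ContMDiffAt (𝓡 n) ((𝓡 n).prod 𝓘(ℝ, Model n →L[ℝ] ℝ)) ∞
    (fun p => TotalSpace.mk' (Model n →L[ℝ] ℝ)
      (E := fun p : M => TangentSpace (𝓡 n) p →L[ℝ] ℝ) p (θ p)) p

/-- The vector field `Y` is smooth at `p`. -/
abbrev SmoothVectorAt (Y : ∀ p : M, TangentSpace (𝓡 n) p) (p : M) : Prop :=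
  ContMDiffAt (𝓡 n) ((𝓡 n).prod 𝓘(ℝ, Model n)) ∞
    (fun q => TotalSpace.mk' (Model n) (E := (TangentSpace (𝓡 n) : M → Type _)) q (Y q)) p

/-- The linear coordinates on tangent spaces given by the chart at `p₀`. -/
noncomputable def coordMap (p₀ q : M) : TangentSpace (𝓡 n) q →L[ℝ] Model n :=
  (trivializationAt (Model n) (TangentSpace (𝓡 n) : M → Type _) p₀).continuousLinearMapAt ℝ q

/-- The inverse of `coordMap`. -/
noncomputable def coordSymm (p₀ q : M) : Model n →L[ℝ] TangentSpace (𝓡 n) q :=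
  (trivializationAt (Model n) (TangentSpace (𝓡 n) : M → Type _) p₀).symmL ℝ q

theorem coordMap_coordSymm {p₀ q : M} (hq : q ∈ (chartAt (Model n) p₀).source) (v : Model n) :
    coordMap p₀ q (coordSymm p₀ q v) = v :=
  Trivialization.continuousLinearMapAt_symmL (R := ℝ)
    (trivializationAt (Model n) (TangentSpace (𝓡 n) : M → Type _) p₀) hq v

theorem coordSymm_coordMap {p₀ q : M} (hq : q ∈ (chartAt (Model n) p₀).source)
    (v : TangentSpace (𝓡 n) q) : coordSymm p₀ q (coordMap p₀ q v) = v :=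
  Trivialization.symmL_continuousLinearMapAt (R := ℝ)
    (trivializationAt (Model n) (TangentSpace (𝓡 n) : M → Type _) p₀) hq v

theorem SmoothVectorAt.diffAt {Y : ∀ p : M, TangentSpace (𝓡 n) p} {p : M}
    (h : SmoothVectorAt Y p) : DiffAt Y p := ContMDiffAt.mdifferentiableAt h (by simp)

theorem SmoothCovectorAt.smooth_pairing {θ : ∀ p : M, TangentSpace (𝓡 n) p →L[ℝ] ℝ}
    {Y : ∀ p : M, TangentSpace (𝓡 n) p} {p : M} (hθ : SmoothCovectorAt θ p)
    (hY : SmoothVectorAt Y p) : ContMDiffAt (𝓡 n) 𝓘(ℝ, ℝ) ∞ (fun q => θ q (Y q)) p := by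
  have h := ContMDiffAt.clm_bundle_apply (E₂ := Bundle.Trivial M ℝ) hθ hY
  rw [contMDiffAt_totalSpace] at h
  exact h.2

theorem SmoothCovectorAt.mdifferentiableAt_pairing {θ : ∀ p : M, TangentSpace (𝓡 n) p →L[ℝ] ℝ}
    {Y : ∀ p : M, TangentSpace (𝓡 n) p} {p : M} (hθ : SmoothCovectorAt θ p)
    (hY : DiffAt Y p) : MDifferentiableAt (𝓡 n) 𝓘(ℝ, ℝ) (fun q => θ q (Y q)) p := by
  have h := (ContMDiffAt.mdifferentiableAt hθ (by simp)).clm_bundle_apply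
    (E₂ := Bundle.Trivial M ℝ) hY
  rw [mdifferentiableAt_totalSpace] at h
  exact h.2

theorem smoothCovectorAt_comp_coordMap {p₀ q : M} (hq : q ∈ (chartAt (Model n) p₀).source)
    {w : M → (Model n →L[ℝ] ℝ)} (hw : ContMDiffAt (𝓡 n) 𝓘(ℝ, Model n →L[ℝ] ℝ) ∞ w q) :
    SmoothCovectorAt (fun r => w r ∘L coordMap p₀ r) q := by
  have hm : q ∈ (trivializationAt (Model n →L[ℝ] ℝ)
      (fun p : M => TangentSpace (𝓡 n) p →L[ℝ] Bundle.Trivial M ℝ p) p₀).baseSet := by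
    rw [hom_trivializationAt_baseSet]
    exact ⟨hq, Set.mem_univ _⟩
  refine ((trivializationAt (Model n →L[ℝ] ℝ)
      (fun p : M => TangentSpace (𝓡 n) p →L[ℝ] Bundle.Trivial M ℝ p) p₀).contMDiffAt_section_iff
        hm).2 ?_
  refine hw.congr_of_eventuallyEq ?_
  filter_upwards [(chartAt (Model n) p₀).open_source.mem_nhds hq] with r hr
  rw [hom_trivializationAt_apply]
  ext v
  have e : (trivializationAt ℝ (Bundle.Trivial M ℝ) p₀).continuousLinearMapAt ℝ r =
    ContinuousLinearMap.id ℝ ℝ := Bundle.Trivial.continuousLinearMapAt_trivialization ℝ M ℝ r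
  rw [ContinuousLinearMap.inCoordinates, e]
  exact congrArg (w r) (coordMap_coordSymm hr v)

theorem smoothCovectorAt_mvfderiv {f : M → ℝ} {p : M}
    (hf : ContMDiffAt (𝓡 n) 𝓘(ℝ, ℝ) ∞ f p) : SmoothCovectorAt (mvfderiv (𝓡 n) f) p := by
  refine (contMDiffAt_hom_bundle (E₂ := Bundle.Trivial M ℝ) _).2 ⟨contMDiffAt_id, ?_⟩
  have h := hf.mfderiv_const (m := ∞) (by simp)
  refine h.congr_of_eventuallyEq (Eventually.of_forall fun r => ?_)
  ext v
  simp [inTangentCoordinates, ContinuousLinearMap.inCoordinates]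
  rfl

omit [IsManifold (𝓡 n) ∞ M] in
theorem contMDiffAt_model_smulRight {E : Type*} [NormedAddCommGroup E] [NormedSpace ℝ E]
    {a : M → (E →L[ℝ] ℝ)} {v : M → E} {p : M} (ha : ContMDiffAt (𝓡 n) 𝓘(ℝ, E →L[ℝ] ℝ) ∞ a p)
    (hv : ContMDiffAt (𝓡 n) 𝓘(ℝ, E) ∞ v p) :
    ContMDiffAt (𝓡 n) 𝓘(ℝ, E →L[ℝ] E) ∞ (fun q => (a q).smulRight (v q)) p :=
  (isBoundedBilinearMap_smulRight (𝕜 := ℝ) (E := E) (F := E)).contDiff.comp_contMDiffAt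
    (ha.prodMk_space hv)

/-- The endomorphism field `α ⊗ V`. -/
theorem contMDiffAt_smulRight {α : ∀ p : M, TangentSpace (𝓡 n) p →L[ℝ] ℝ}
    {V : ∀ p : M, TangentSpace (𝓡 n) p} {p : M} (hα : SmoothCovectorAt α p)
    (hV : SmoothVectorAt V p) :
    ContMDiffAt (𝓡 n) ((𝓡 n).prod 𝓘(ℝ, Model n →L[ℝ] Model n)) ∞
      (fun q => TotalSpace.mk' (Model n →L[ℝ] Model n)
        (E := fun q : M => TangentSpace (𝓡 n) q →L[ℝ] TangentSpace (𝓡 n) q) q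
        ((α q).smulRight (V q))) p := by
  refine (contMDiffAt_hom_bundle _).2 ⟨contMDiffAt_id, ?_⟩
  have h1 := ((contMDiffAt_hom_bundle (E₂ := Bundle.Trivial M ℝ) _).1 hα).2
  have h2 := (contMDiffAt_totalSpace.1 hV).2
  have h3 := contMDiffAt_model_smulRight h1 h2
  refine h3.congr_of_eventuallyEq ?_
  filter_upwards [(chartAt (Model n) p).open_source.mem_nhds (mem_chart_source (Model n) p)]
    with r hr
  have hr' : r ∈ (trivializationAt (Model n) (TangentSpace (𝓡 n) : M → Type _) p).baseSet := hr
  ext v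
  simp [ContinuousLinearMap.inCoordinates, Trivialization.coe_linearMapAt_of_mem _ hr']

/-- Every covector field with smooth coordinates near a point extends globally. -/
theorem exists_oneForm [T2Space M] (p₀ : M) (ξ : Model n →L[ℝ] ℝ) :
    ∃ θ : OneForm n M, ∀ᶠ q in 𝓝 p₀, θ.toFun q = ξ ∘L coordMap p₀ q := by
  let f : SmoothBumpFunction (𝓡 n) p₀ := Classical.arbitrary _
  have hs : ContMDiff (𝓡 n) ((𝓡 n).prod 𝓘(ℝ, Model n →L[ℝ] ℝ)) ∞
      (fun p => TotalSpace.mk' (Model n →L[ℝ] ℝ)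
      (E := fun p : M => TangentSpace (𝓡 n) p →L[ℝ] ℝ) p (f p • (ξ ∘L coordMap p₀ p))) := by
    refine ContMDiffOn.smul_section_of_tsupport (V := fun p : M => TangentSpace (𝓡 n) p →L[ℝ] ℝ)
      (u := (chartAt (Model n) p₀).source) (f.contMDiff.contMDiffOn)
      (chartAt (Model n) p₀).open_source f.tsupport_subset_chartAt_source ?_
    intro q hq
    exact ContMDiffAt.contMDiffWithinAt (smoothCovectorAt_comp_coordMap hq contMDiffAt_const)
  refine ⟨⟨_, hs⟩, ?_⟩
  filter_upwards [f.eventuallyEq_one] with q hq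
  simp [hq]

/-- The vector field with coordinates `w` in the chart at `p₀`. -/
theorem smoothVectorAt_coordSymm {p₀ q : M} (hq : q ∈ (chartAt (Model n) p₀).source)
    {w : M → Model n} (hw : ContMDiffAt (𝓡 n) 𝓘(ℝ, Model n) ∞ w q) :
    SmoothVectorAt (fun r => coordSymm p₀ r (w r)) q := by
  refine ((trivializationAt (Model n) (TangentSpace (𝓡 n) : M → Type _)
    p₀).contMDiffAt_section_iff hq).2 ?_
  refine hw.congr_of_eventuallyEq ?_
  filter_upwards [(chartAt (Model n) p₀).open_source.mem_nhds hq] with r hr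
  have hr' : r ∈ (trivializationAt (Model n) (TangentSpace (𝓡 n) : M → Type _) p₀).baseSet := hr
  simp [coordSymm, Trivialization.symmL_apply _ hr', Trivialization.apply_mk_symm _ hr']

/-! ### Lie brackets as commutators of derivations. -/

theorem two_le_infty : (2 : WithTop ℕ∞) ≤ ∞ :=
  WithTop.coe_le_coe.2 (le_top : (2 : ℕ∞) ≤ ⊤)

theorem three_le_infty : (3 : WithTop ℕ∞) ≤ ∞ :=
  WithTop.coe_le_coe.2 (le_top : (3 : ℕ∞) ≤ ⊤)

/-- The Leibniz rule applied twice. The two middle terms together are symmetric in `X` and `Y`, so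
they cancel in the Jacobi identity. -/
theorem mlieBracket_mlieBracket_smul {X Y Z : ∀ p : M, TangentSpace (𝓡 n) p} {f : M → ℝ} {p : M}
    (hY : SmoothVectorAt Y p) (hZ : ∀ᶠ q in 𝓝 p, SmoothVectorAt Z q)
    (hf : ∀ᶠ q in 𝓝 p, ContMDiffAt (𝓡 n) 𝓘(ℝ, ℝ) ∞ f q) :
    VectorField.mlieBracket (𝓡 n) X (VectorField.mlieBracket (𝓡 n) Y (f • Z)) p =
      mvfderiv (𝓡 n) (fun q => mvfderiv (𝓡 n) f q (Y q)) p (X p) • Z p +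
      mvfderiv (𝓡 n) f p (Y p) • VectorField.mlieBracket (𝓡 n) X Z p +
      (mvfderiv (𝓡 n) f p (X p) • VectorField.mlieBracket (𝓡 n) Y Z p +
      f p • VectorField.mlieBracket (𝓡 n) X (VectorField.mlieBracket (𝓡 n) Y Z) p) := by
  have h1 : VectorField.mlieBracket (𝓡 n) Y (f • Z) =ᶠ[𝓝 p]
      (fun q => mvfderiv (𝓡 n) f q (Y q)) • Z + f • VectorField.mlieBracket (𝓡 n) Y Z := by
    filter_upwards [hZ, hf] with q hZq hfq
    exact VectorField.mlieBracket_smul_right (hfq.mdifferentiableAt (by simp)) hZq.diffAt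
  have hYf : MDifferentiableAt (𝓡 n) 𝓘(ℝ, ℝ) (fun q => mvfderiv (𝓡 n) f q (Y q)) p :=
    (smoothCovectorAt_mvfderiv hf.self_of_nhds).mdifferentiableAt_pairing hY.diffAt
  have hfp := hf.self_of_nhds.mdifferentiableAt (by simp)
  have hZp := hZ.self_of_nhds.diffAt
  have : IsManifold (𝓡 n) ((2 : ℕ∞) + 1) M := IsManifold.of_le (n := ∞) (by exact_mod_cast le_top)
  have : IsManifold (𝓡 n) (minSmoothness ℝ 2) M :=
    IsManifold.of_le (n := ∞) (by simpa using two_le_infty)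
  have hYZ : DiffAt (VectorField.mlieBracket (𝓡 n) Y Z) p :=
    (ContMDiffAt.mlieBracket_vectorField (m := 1) (n := 2)
      (hY.of_le (by exact_mod_cast le_top)) (hZ.self_of_nhds.of_le (by exact_mod_cast le_top))
      (by simp; norm_num)).mdifferentiableAt (by simp)
  rw [Filter.EventuallyEq.mlieBracket_vectorField_eq (EventuallyEq.refl _ X) h1,
    VectorField.mlieBracket_add_right (hYf.smul_section hZp) (hfp.smul_section hYZ),
    VectorField.mlieBracket_smul_right hYf hZp, VectorField.mlieBracket_smul_right hfp hYZ]

/-- The Lie bracket acts on functions as the commutator of derivations. -/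
theorem mvfderiv_mlieBracket [NeZero n] {X Y : ∀ p : M, TangentSpace (𝓡 n) p} {f : M → ℝ} {p : M}
    (hX : SmoothVectorAt X p) (hY : SmoothVectorAt Y p)
    (hf : ∀ᶠ q in 𝓝 p, ContMDiffAt (𝓡 n) 𝓘(ℝ, ℝ) ∞ f q) :
    mvfderiv (𝓡 n) f p (VectorField.mlieBracket (𝓡 n) X Y p) =
      mvfderiv (𝓡 n) (fun q => mvfderiv (𝓡 n) f q (Y q)) p (X p) -
        mvfderiv (𝓡 n) (fun q => mvfderiv (𝓡 n) f q (X q)) p (Y p) := by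
  -- The Jacobi identity for `X`, `Y`, `f Z` minus `f` times the one for `X`, `Y`, `Z` leaves the
  -- desired identity multiplied by `Z p`, so any local field with `Z p ≠ 0` will do.
  let u : Model n := EuclideanSpace.single 0 1
  let Z : ∀ q : M, TangentSpace (𝓡 n) q := fun r => coordSymm p r u
  have hZ : ∀ᶠ q in 𝓝 p, SmoothVectorAt Z q := by
    filter_upwards [(chartAt (Model n) p).open_source.mem_nhds (mem_chart_source (Model n) p)]
      with q hq using smoothVectorAt_coordSymm hq contMDiffAt_const
  have hZ0 : Z p ≠ 0 := by
    intro h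
    have h2 := congrArg (coordMap p p) h
    have h3 : coordMap p p (Z p) = u := coordMap_coordSymm (mem_chart_source (Model n) p) u
    rw [h3, map_zero] at h2
    simpa [u] using congrArg (fun v : Model n => v 0) h2
  have : IsManifold (𝓡 n) ((2 : ℕ∞) + 1) M := IsManifold.of_le (n := ∞) (by exact_mod_cast le_top)
  have : IsManifold (𝓡 n) (minSmoothness ℝ 3) M :=
    IsManifold.of_le (n := ∞) (by simpa using three_le_infty)
  have hle : minSmoothness ℝ 2 ≤ (∞ : WithTop ℕ∞) := by simpa using two_le_infty
  have hfZ : SmoothVectorAt (f • Z) p := hf.self_of_nhds.smul_section hZ.self_of_nhds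
  have j1 := VectorField.leibniz_identity_mlieBracket_apply (I := 𝓡 n) (U := X) (V := Y)
    (W := f • Z) (x := p) (hX.of_le hle) (hY.of_le hle) (hfZ.of_le hle)
  have j2 := VectorField.leibniz_identity_mlieBracket_apply (I := 𝓡 n) (U := X) (V := Y) (W := Z)
    (x := p) (hX.of_le hle) (hY.of_le hle) (hZ.self_of_nhds.of_le hle)
  rw [mlieBracket_mlieBracket_smul hY hZ hf, mlieBracket_mlieBracket_smul hX hZ hf,
    VectorField.mlieBracket_smul_right (hf.self_of_nhds.mdifferentiableAt (by simp))
      hZ.self_of_nhds.diffAt, j2] at j1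
  have j3 : (mvfderiv (𝓡 n) f p (VectorField.mlieBracket (𝓡 n) X Y p) -
      (mvfderiv (𝓡 n) (fun q => mvfderiv (𝓡 n) f q (Y q)) p (X p) -
        mvfderiv (𝓡 n) (fun q => mvfderiv (𝓡 n) f q (X q)) p (Y p))) • Z p = 0 := by
    rw [← neg_eq_zero, ← sub_eq_zero.2 j1]
    module
  exact sub_eq_zero.1 ((smul_eq_zero.1 j3).resolve_right hZ0)

/-! ### Differentials of functions and infinitesimal symmetries of symbols. -/

omit [IsManifold (𝓡 n) ∞ M] in
theorem mvfderiv_congr {f g : M → ℝ} {p : M} (h : f =ᶠ[𝓝 p] g) :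
    mvfderiv (𝓡 n) f p = mvfderiv (𝓡 n) g p := by
  ext v
  exact congrArg (fun L : TangentSpace (𝓡 n) p →L[ℝ] ℝ => L v) h.mfderiv_eq

theorem transpose_apply {V V' : Type*} [AddCommGroup V] [Module ℝ V] [TopologicalSpace V]
    [AddCommGroup V'] [Module ℝ V'] [TopologicalSpace V'] (φ : V ≃L[ℝ] V') (ξ : V' →L[ℝ] ℝ) :
    transpose φ ξ = ξ ∘L (φ : V →L[ℝ] V') := rfl

omit [IsManifold (𝓡 n) ∞ M] in
theorem mvfderiv_finsetSum {ι : Type*} (s : Finset ι) {f : ι → M → ℝ} {p : M}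
    (hf : ∀ i, MDifferentiableAt (𝓡 n) 𝓘(ℝ, ℝ) (f i) p) :
    MDifferentiableAt (𝓡 n) 𝓘(ℝ, ℝ) (fun q => ∑ i ∈ s, f i q) p ∧
      mvfderiv (𝓡 n) (fun q => ∑ i ∈ s, f i q) p = ∑ i ∈ s, mvfderiv (𝓡 n) (f i) p := by
  classical
  induction s using Finset.induction_on with
  | empty => exact ⟨by simpa using mdifferentiableAt_const, by simpa using mvfderiv_const 0⟩
  | insert i s hi ih =>
    simp only [Finset.sum_insert hi]
    exact ⟨(hf i).add ih.1, by rw [mvfderiv_fun_add (hf i) ih.1, ih.2]⟩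

omit [IsManifold (𝓡 n) ∞ M] in
theorem mvfderiv_comp_of_hasFDerivAt {V : Type*} [NormedAddCommGroup V] [NormedSpace ℝ V]
    {g : V → ℝ} {g' : V →L[ℝ] ℝ} {a : M → V} {p : M} (hg : HasFDerivAt g g' (a p))
    (ha : MDifferentiableAt (𝓡 n) 𝓘(ℝ, V) a p) (X : TangentSpace (𝓡 n) p) :
    mvfderiv (𝓡 n) (fun q => g (a q)) p X = g' (mvfderiv (𝓡 n) a p X) := by
  have h := (hg.hasMFDerivAt.comp p ha.hasMFDerivAt).mfderiv
  exact congrArg (fun L : TangentSpace (𝓡 n) p →L[ℝ] ℝ => L X) h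

/-- The only infinitesimal symmetry of a regular symbol at a point is zero. -/
theorem Symbol.IsRegular.eq_zero_of_infinitesimal_symmetry {k : ℕ} {σ : Symbol k n M}
    (hσ : σ.IsRegular) (p : M) (N : TangentSpace (𝓡 n) p →L[ℝ] TangentSpace (𝓡 n) p)
    (hN : ∀ ξ : Fin k → (TangentSpace (𝓡 n) p →L[ℝ] ℝ),
      ∑ i, σ.toFun p (Function.update ξ i (ξ i ∘L N)) = 0) : N = 0 := by
  let φ : TangentSpace (𝓡 n) p ≃L[ℝ] Model n :=
    (trivializationAt (Model n) (TangentSpace (𝓡 n) : M → Type _) p).continuousLinearEquivAt ℝ p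
      (mem_chart_source (Model n) p)
  let A : Model n →L[ℝ] Model n := (φ : _ →L[ℝ] _) ∘L N ∘L (φ.symm : _ →L[ℝ] _)
  -- The form lives on the dual space, where the endomorphism acts by the transpose `ξ ↦ ξ ∘ A`.
  have h := WagnerConnection.eq_zero_of_infinitesimal_symmetry (pushforward φ (σ.toFun p)) (hσ p φ)
    ((ContinuousLinearMap.compL ℝ (Model n) (Model n) ℝ).flip A) (fun ξ => by
      rw [← hN (fun i => ξ i ∘L (φ : _ →L[ℝ] _))]
      refine Finset.sum_congr rfl fun i _ => ?_
      simp only [pushforward, MultilinearMap.compLinearMap_apply]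
      congr 1
      ext j v
      by_cases hj : j = i
      · subst hj
        simp [transpose_apply, A]
      · simp [transpose_apply, hj])
  ext v
  apply φ.injective
  rw [zero_apply, map_zero]
  ext i
  have := congrArg (fun L : (Model n →L[ℝ] ℝ) →L[ℝ] (Model n →L[ℝ] ℝ) =>
    L (EuclideanSpace.proj i) (φ v)) h
  simpa [A] using this

/-! ### Adapted frames and the connections that they define. -/

/-- `θ`, `F` are dual frames of the cotangent and the tangent bundle, smooth at `q`. -/
structure IsDualFrameAt (θ : Fin n → ∀ q : M, TangentSpace (𝓡 n) q →L[ℝ] ℝ)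
    (F : Fin n → ∀ q : M, TangentSpace (𝓡 n) q) (q : M) : Prop where
  expand : ∀ v : TangentSpace (𝓡 n) q, ∑ i, θ i q v • F i q = v
  pair : ∀ i j, θ i q (F j q) = if i = j then 1 else 0
  smooth_coframe : ∀ i, SmoothCovectorAt (θ i) q
  smooth_frame : ∀ i, SmoothVectorAt (F i) q

/-- The dual frames `θ`, `F` near `p` are adapted to `σ`: the components of `σ` are constant. -/
structure IsAdapted {k : ℕ} (σ : Symbol k n M)
    (θ : Fin n → ∀ q : M, TangentSpace (𝓡 n) q →L[ℝ] ℝ)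
    (F : Fin n → ∀ q : M, TangentSpace (𝓡 n) q) (p : M) : Prop where
  dual : ∀ᶠ q in 𝓝 p, IsDualFrameAt θ F q
  const : ∀ᶠ q in 𝓝 p, ∀ I : Fin k → Fin n,
    σ.toFun q (fun j => θ (I j) q) = σ.toFun p (fun j => θ (I j) p)

theorem IsAdapted.eventually {k : ℕ} {σ : Symbol k n M}
    {θ : Fin n → ∀ q : M, TangentSpace (𝓡 n) q →L[ℝ] ℝ}
    {F : Fin n → ∀ q : M, TangentSpace (𝓡 n) q} {p : M} (h : IsAdapted σ θ F p) :
    ∀ᶠ q in 𝓝 p, IsAdapted σ θ F q := by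
  filter_upwards [h.dual.eventually_nhds, h.const.eventually_nhds] with q h1 h2
  refine ⟨h1, ?_⟩
  filter_upwards [h2] with r hr I
  rw [hr I, h2.self_of_nhds I]

/-- The covariant derivative for which the frame `F` with dual coframe `θ` is parallel. -/
noncomputable def frameDeriv (θ : Fin n → ∀ q : M, TangentSpace (𝓡 n) q →L[ℝ] ℝ)
    (F : Fin n → ∀ q : M, TangentSpace (𝓡 n) q) (Y : ∀ q : M, TangentSpace (𝓡 n) q) (p : M) :
    TangentSpace (𝓡 n) p →L[ℝ] TangentSpace (𝓡 n) p :=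
  ∑ i, (mvfderiv (𝓡 n) (fun q => θ i q (Y q)) p).smulRight (F i p)

omit [IsManifold (𝓡 n) ∞ M] in
theorem frameDeriv_apply (θ : Fin n → ∀ q : M, TangentSpace (𝓡 n) q →L[ℝ] ℝ)
    (F : Fin n → ∀ q : M, TangentSpace (𝓡 n) q) (Y : ∀ q : M, TangentSpace (𝓡 n) q) (p : M)
    (X : TangentSpace (𝓡 n) p) :
    frameDeriv θ F Y p X = ∑ i, mvfderiv (𝓡 n) (fun q => θ i q (Y q)) p X • F i p := by
  rw [frameDeriv, sum_apply]
  rfl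

theorem IsDualFrameAt.isCovariantDerivativeOn
    {θ : Fin n → ∀ q : M, TangentSpace (𝓡 n) q →L[ℝ] ℝ}
    {F : Fin n → ∀ q : M, TangentSpace (𝓡 n) q} {p : M} (h : IsDualFrameAt θ F p) :
    IsCovariantDerivativeOn (Model n) (frameDeriv θ F) {p} where
  add {Y Y' x} hY hY' hx := by
    obtain rfl : x = p := hx
    ext1 X
    rw [add_apply]
    simp only [frameDeriv_apply]
    rw [← Finset.sum_add_distrib]
    refine Finset.sum_congr rfl fun i _ => ?_
    rw [← add_smul]
    congr 1
    have e := mvfderiv_fun_add ((h.smooth_coframe i).mdifferentiableAt_pairing hY)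
      ((h.smooth_coframe i).mdifferentiableAt_pairing hY')
    rw [← add_apply, ← e]
    simp
  leibniz {Y f x} hY hf hx := by
    obtain rfl : x = p := hx
    ext1 X
    have e : ∀ i, mvfderiv (𝓡 n) (fun q => θ i q ((f • Y) q)) x X =
        f x * mvfderiv (𝓡 n) (fun q => θ i q (Y q)) x X +
          mvfderiv (𝓡 n) f x X * θ i x (Y x) := by
      intro i
      have h2 := mvfderiv_fun_mul hf ((h.smooth_coframe i).mdifferentiableAt_pairing hY)
      have h3 : (fun q => θ i q ((f • Y) q)) = fun q => f q * θ i q (Y q) := by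
        ext q
        simp
      rw [h3, h2]
      simp
      ring
    simp only [add_apply, smul_apply,
      ContinuousLinearMap.smulRight_apply, frameDeriv_apply, e]
    rw [show mvfderiv (𝓡 n) f x X • Y x = mvfderiv (𝓡 n) f x X • ∑ i, θ i x (Y x) • F i x by
      rw [h.expand]]
    simp only [Finset.smul_sum, add_smul, Finset.sum_add_distrib, mul_smul]

/-- The operator `C` preserves `σ` at `p`; here `η j` is the derivative of the form `α j`. -/
def IsParallelAt {k : ℕ} (σ : Symbol k n M)
    (C : (∀ q : M, TangentSpace (𝓡 n) q) → ∀ q : M, TangentSpace (𝓡 n) q →L[ℝ]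
      TangentSpace (𝓡 n) q) (p : M) : Prop :=
  ∀ (α : Fin k → OneForm n M) (X : TangentSpace (𝓡 n) p),
    ∃ η : Fin k → (TangentSpace (𝓡 n) p →L[ℝ] ℝ),
      (∀ j (Y : ∀ q : M, TangentSpace (𝓡 n) q), DiffAt Y p →
        η j (Y p) = mvfderiv (𝓡 n) (fun q => (α j).toFun q (Y q)) p X - (α j).toFun p (C Y p X)) ∧
      mvfderiv (𝓡 n) (fun q => σ.toFun q (fun i => (α i).toFun q)) p X =
        ∑ i, σ.toFun p (Function.update (fun j => (α j).toFun p) i (η i))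

theorem exists_vectorField (p : M) (v : TangentSpace (𝓡 n) p) :
    ∃ Y : ∀ q : M, TangentSpace (𝓡 n) q, SmoothVectorAt Y p ∧ Y p = v :=
  ⟨fun r => coordSymm p r (coordMap p p v),
    smoothVectorAt_coordSymm (mem_chart_source (Model n) p) contMDiffAt_const,
    coordSymm_coordMap (mem_chart_source (Model n) p) v⟩

/-- Each tangent vector extends to a field smooth at `p`, so the equation for `η j` determines it,
and `dualDeriv` solves that equation. The form with `η` also makes sense for operators that are
covariant derivatives only at `p`, such as `frameDeriv`. -/
theorem isParallelAt_connection_iff {k : ℕ} (σ : Symbol k n M) (D : Connection n M) (p : M) :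
    IsParallelAt σ D.toFun p ↔
      ∀ (α : Fin k → OneForm n M) (X : TangentSpace (𝓡 n) p), symbolDeriv D σ α p X = 0 := by
  have hη : ∀ (θ : OneForm n M) (X : TangentSpace (𝓡 n) p)
      (Y : ∀ q : M, TangentSpace (𝓡 n) q), DiffAt Y p → dualDeriv D θ p X (Y p) =
        mvfderiv (𝓡 n) (fun q => θ.toFun q (Y q)) p X - θ.toFun p (D.toFun Y p X) :=
    fun θ X Y hY => TensorialAt.mkHom_apply (dualDerivAux_tensorial D θ p X) hY
  constructor
  · intro h α X
    obtain ⟨η, h1, h2⟩ := h α X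
    have e : ∀ j, dualDeriv D (α j) p X = η j := by
      intro j
      ext v
      obtain ⟨Y, hY, rfl⟩ := exists_vectorField p v
      rw [hη _ _ _ hY.diffAt, h1 j Y hY.diffAt]
    simp only [symbolDeriv, h2, e, sub_self]
  · intro h α X
    exact ⟨fun j => dualDeriv D (α j) p X, fun j Y hY => hη _ _ _ hY, sub_eq_zero.1 (h α X)⟩

/-- A covariant derivative at a point is determined by the condition that it preserves a regular
symbol. -/
theorem IsParallelAt.unique [T2Space M] {k : ℕ} {σ : Symbol k n M} (hσ : σ.IsRegular) {p : M}
    {C C' : (∀ q : M, TangentSpace (𝓡 n) q) → ∀ q : M, TangentSpace (𝓡 n) q →L[ℝ]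
      TangentSpace (𝓡 n) q}
    (hC : IsCovariantDerivativeOn (Model n) C {p}) (hC' : IsCovariantDerivativeOn (Model n) C' {p})
    (h : IsParallelAt σ C p) (h' : IsParallelAt σ C' p) {Y : ∀ q : M, TangentSpace (𝓡 n) q}
    (hY : DiffAt Y p) : C Y p = C' Y p := by
  have : IsManifold (𝓡 n) 1 M := IsManifold.of_le (n := ∞) (by simp)
  let Δ := IsCovariantDerivativeOn.difference hC hC' p
  have hΔ : ∀ Y : ∀ q : M, TangentSpace (𝓡 n) q, DiffAt Y p → Δ (Y p) = C Y p - C' Y p :=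
    fun Y hY => IsCovariantDerivativeOn.difference_apply hC hC' (Set.mem_singleton p) hY
  ext1 X
  -- The difference of two covariant derivatives is tensorial; `N` is its value in the direction
  -- `X`.
  let N : TangentSpace (𝓡 n) p →L[ℝ] TangentSpace (𝓡 n) p :=
    { toFun := fun v => Δ v X
      map_add' := fun v w => by simp
      map_smul' := fun c v => by simp
      cont := by fun_prop }
  have hNv : ∀ v, N v = Δ v X := fun v => rfl
  have hN := hσ.eq_zero_of_infinitesimal_symmetry p N (fun ξ => by
    choose α hα using fun j => exists_oneForm p (ξ j ∘L coordSymm p p)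
    have hα' : ∀ j, (α j).toFun p = ξ j := fun j => by
      rw [(hα j).self_of_nhds]
      ext v
      exact congrArg (ξ j) (coordSymm_coordMap (mem_chart_source (Model n) p) v)
    obtain ⟨η, h1, h2⟩ := h α X
    obtain ⟨η', h1', h2'⟩ := h' α X
    -- Both sums over the `η j` and the `η' j` equal the derivative of `σ(α)` along `X`, so their
    -- difference, the action of `N` on `σ`, vanishes.
    have e : ∀ j, ξ j ∘L N = η' j - η j := by
      intro j
      ext v
      obtain ⟨Y, hY, rfl⟩ := exists_vectorField p v
      simp only [ContinuousLinearMap.comp_apply, hNv,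
        sub_apply, hΔ Y hY.diffAt, h1 j Y hY.diffAt, h1' j Y hY.diffAt,
        hα', map_sub]
      ring
    simp only [e, MultilinearMap.map_update_sub, Finset.sum_sub_distrib]
    simp only [hα'] at h2 h2'
    rw [← h2, ← h2', sub_self])
  have := congrArg (fun L : TangentSpace (𝓡 n) p →L[ℝ] TangentSpace (𝓡 n) p => L (Y p)) hN
  simp only [hNv, hΔ Y hY, zero_apply,
    sub_apply] at this
  exact sub_eq_zero.1 this

/-- The covariant derivative of an adapted frame preserves the symbol. -/
theorem IsAdapted.isParallelAt {k : ℕ} {σ : Symbol k n M}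
    {θ : Fin n → ∀ q : M, TangentSpace (𝓡 n) q →L[ℝ] ℝ}
    {F : Fin n → ∀ q : M, TangentSpace (𝓡 n) q} {p : M} (h : IsAdapted σ θ F p) :
    IsParallelAt σ (frameDeriv θ F) p := by
  intro α X
  have hd := h.dual.self_of_nhds
  let a : M → Fin k → Fin n → ℝ := fun q j i => (α j).toFun q (F i q)
  have ha : ∀ j i, MDifferentiableAt (𝓡 n) 𝓘(ℝ, ℝ) (fun q => a q j i) p := fun j i =>
    mdifferentiableAt_pairing (α j) (hd.smooth_frame i).diffAt
  have hexp : ∀ q, IsDualFrameAt θ F q → ∀ j, (α j).toFun q = ∑ i, a q j i • θ i q := by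
    intro q hq j
    ext v
    conv_lhs => rw [← hq.expand v]
    simp [a, mul_comm]
  let b : Fin k → Fin n → ℝ := fun j i => mvfderiv (𝓡 n) (fun q => a q j i) p X
  refine ⟨fun j => ∑ i, b j i • θ i p, fun j Y hY => ?_, ?_⟩
  · have h1 : (fun q => (α j).toFun q (Y q)) =ᶠ[𝓝 p] fun q => ∑ i, a q j i * θ i q (Y q) := by
      filter_upwards [h.dual] with q hq
      rw [hexp q hq j]
      simp [sum_apply]
    have h2 : ∀ i, MDifferentiableAt (𝓡 n) 𝓘(ℝ, ℝ) (fun q => θ i q (Y q)) p := fun i =>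
      (hd.smooth_coframe i).mdifferentiableAt_pairing hY
    rw [mvfderiv_congr h1, (mvfderiv_finsetSum Finset.univ
      (f := fun i q => a q j i * θ i q (Y q)) fun i => (ha j i).mul (h2 i)).2,
      frameDeriv_apply, sum_apply, sum_apply, map_sum, ← Finset.sum_sub_distrib]
    refine Finset.sum_congr rfl fun i _ => ?_
    rw [mvfderiv_fun_mul (ha j i) (h2 i)]
    simp [a, b]
    ring
  -- As the components of `σ` are constant, `σ(α)` near `p` is one fixed multilinear function `T` of
  -- the coefficients `a` of the forms, and only these get differentiated.
  · let T : MultilinearMap ℝ (fun _ : Fin k => Fin n → ℝ) ℝ :=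
      (σ.toFun p).compLinearMap fun _ => Fintype.linearCombination ℝ (fun i => θ i p)
    have hT : ∀ c, T c = σ.toFun p (fun j => ∑ i, c j i • θ i p) := fun c => by
      simp [T, Fintype.linearCombination_apply]
    have h1 : (fun q => σ.toFun q (fun i => (α i).toFun q)) =ᶠ[𝓝 p] fun q => T (a q) := by
      filter_upwards [h.dual, h.const] with q hq hc
      rw [hT]
      simp only [hexp q hq, MultilinearMap.map_sum, MultilinearMap.map_smul_univ, hc]
    have ha' : MDifferentiableAt (𝓡 n) 𝓘(ℝ, Fin k → Fin n → ℝ) a p := by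
      refine ContMDiffAt.mdifferentiableAt (n := ∞) ?_ (by simp)
      exact contMDiffAt_pi_space.2 fun j => contMDiffAt_pi_space.2 fun i =>
        SmoothCovectorAt.smooth_pairing ((α j).smooth p) (hd.smooth_frame i)
    have hb : mvfderiv (𝓡 n) a p X = b := by
      ext j i
      have := mvfderiv_comp_of_hasFDerivAt
        ((ContinuousLinearMap.proj (R := ℝ) (φ := fun _ : Fin n => ℝ) i ∘L
          ContinuousLinearMap.proj (R := ℝ) (φ := fun _ : Fin k => Fin n → ℝ) j).hasFDerivAt)
          ha' X
      exact this.symm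
    rw [mvfderiv_congr h1, mvfderiv_comp_of_hasFDerivAt (hasFDerivAt_multilinear T (a p)) ha' X, hb,
      linearDeriv_toContinuousMultilinear]
    refine Finset.sum_congr rfl fun i _ => ?_
    rw [hT]
    congr 1
    ext j v
    by_cases hj : j = i
    · subst hj
      simp
    · simp [hj, hexp p hd]

/-! ### Construction of adapted frames. -/

/-- The linear isomorphism with underlying map `coordMap`. -/
noncomputable def coordEquiv {p₀ q : M} (hq : q ∈ (chartAt (Model n) p₀).source) :
    TangentSpace (𝓡 n) q ≃L[ℝ] Model n :=
  ContinuousLinearEquiv.equivOfInverse (coordMap p₀ q) (coordSymm p₀ q)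
    (coordSymm_coordMap hq) (coordMap_coordSymm hq)

theorem pushforward_coordEquiv_apply {k : ℕ} {p₀ q : M}
    (hq : q ∈ (chartAt (Model n) p₀).source) (τ : Tensor k (TangentSpace (𝓡 n) q))
    (ξ : Fin k → (Model n →L[ℝ] ℝ)) :
    pushforward (coordEquiv hq) τ ξ = τ (fun j => ξ j ∘L coordMap p₀ q) := rfl

/-- The components of a symbol in the chart at `p₀` with respect to a basis `β`. -/
noncomputable def Symbol.components {k : ℕ} (σ : Symbol k n M) (p₀ : M)
    (β : Fin n → (Model n →L[ℝ] ℝ)) (q : M) : (Fin k → Fin n) → ℝ :=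
  fun I => σ.toFun q (fun j => β (I j) ∘L coordMap p₀ q)

/-- Smoothness of a symbol is tested on global forms, so the coordinate covectors are first extended
from a neighbourhood of `p₀` by bump functions. -/
theorem Symbol.contMDiffAt_components [T2Space M] {k : ℕ} (σ : Symbol k n M) (p₀ : M)
    (β : Fin n → (Model n →L[ℝ] ℝ)) :
    ∀ᶠ q in 𝓝 p₀, ContMDiffAt (𝓡 n) 𝓘(ℝ, (Fin k → Fin n) → ℝ) ∞ (σ.components p₀ β) q := by
  choose α hα using fun i => exists_oneForm p₀ (β i)
  have h : ∀ᶠ q in 𝓝 p₀, ∀ i, (α i).toFun q = β i ∘L coordMap p₀ q := eventually_all.2 hα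
  filter_upwards [h.eventually_nhds] with q hq
  refine contMDiffAt_pi_space.2 fun I => ?_
  refine (σ.smooth (fun j => α (I j)) q).congr_of_eventuallyEq ?_
  filter_upwards [hq] with r hr
  simp only [Symbol.components, hr]

theorem Symbol.IsConstantType.exists_symm_comp {k : ℕ} {σ : Symbol k n M} (hσ : σ.IsConstantType)
    {p₀ q : M} (hq : q ∈ (chartAt (Model n) p₀).source) :
    ∃ A : (Model n →L[ℝ] ℝ) ≃L[ℝ] (Model n →L[ℝ] ℝ), ∀ ξ : Fin k → (Model n →L[ℝ] ℝ),
      pushforward (coordEquiv (mem_chart_source (Model n) p₀)) (σ.toFun p₀)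
        (fun j => A.symm (ξ j)) = σ.toFun q (fun j => ξ j ∘L coordMap p₀ q) := by
  obtain ⟨τ, -, hτ⟩ := hσ
  obtain ⟨A, hA⟩ := hτ p₀ (coordEquiv (mem_chart_source (Model n) p₀))
  obtain ⟨A', hA'⟩ := hτ q (coordEquiv hq)
  -- Both values come from one tensor `τ`, by `A` and by `A'`, so `A' A⁻¹` carries the first to the
  -- second; the witness is its contragredient.
  refine ⟨((A.symm.trans A').arrowCongr (ContinuousLinearEquiv.refl ℝ ℝ)), fun ξ => ?_⟩
  rw [← pushforward_coordEquiv_apply hq, ← hA, ← hA']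
  simp only [pushforward, MultilinearMap.compLinearMap_apply]
  congr 1
  ext j v
  simp [transpose_apply]

/-- The linear map with components `w i`. -/
noncomputable def ofComponents (w : Fin n → (Model n →L[ℝ] ℝ)) : Model n →L[ℝ] Model n :=
  ∑ i, (w i).smulRight (EuclideanSpace.single i (1 : ℝ))

theorem ofComponents_apply (w : Fin n → (Model n →L[ℝ] ℝ)) (v : Model n) (i : Fin n) :
    ofComponents w v i = w i v := by
  simp [ofComponents, sum_apply, Finset.sum_apply, Pi.single_apply]

theorem isInvertible_ofComponents {w : Fin n → (Model n →L[ℝ] ℝ)} (hw : LinearIndependent ℝ w) :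
    (ofComponents w).IsInvertible := by
  have hinj : Function.Injective (ofComponents w).toLinearMap := by
    rw [← LinearMap.ker_eq_bot, LinearMap.ker_eq_bot']
    intro v hv
    by_contra hne
    have : (⊤ : Submodule ℝ (Model n →L[ℝ] ℝ)) ≤ LinearMap.ker
        (ContinuousLinearMap.apply ℝ ℝ v).toLinearMap := by
      have hs : Submodule.span ℝ (Set.range w) = ⊤ := by
        refine hw.span_eq_top_of_card_eq_finrank' ?_
        rw [Fintype.card_fin, ← (LinearMap.toContinuousLinearMap
          (E := Model n) (F' := ℝ) (𝕜 := ℝ)).finrank_eq, Module.finrank_linearMap]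
        simp
      rw [← hs, Submodule.span_le]
      rintro _ ⟨i, rfl⟩
      have := congrArg (fun u : Model n => u i) hv
      simpa [ofComponents_apply] using this
    obtain ⟨g, hg⟩ := SeparatingDual.exists_ne_zero (R := ℝ) hne
    exact hg (this (Submodule.mem_top (x := g)))
  refine ⟨(LinearEquiv.ofInjectiveEndo _ hinj).toContinuousLinearEquiv, ?_⟩
  ext v
  rfl

theorem isDualFrameAt_of_components {p₀ q : M} (hq : q ∈ (chartAt (Model n) p₀).source)
    {w : Fin n → M → (Model n →L[ℝ] ℝ)}
    (hw : ∀ i, ContMDiffAt (𝓡 n) 𝓘(ℝ, Model n →L[ℝ] ℝ) ∞ (w i) q)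
    (hB : ∀ᶠ r in 𝓝 q, (ofComponents fun i => w i r).IsInvertible) :
    IsDualFrameAt (fun i r => w i r ∘L coordMap p₀ r)
      (fun i r => coordSymm p₀ r ((ofComponents fun i => w i r).inverse
        (EuclideanSpace.single i 1))) q where
  expand v := by
    obtain ⟨e, he⟩ := hB.self_of_nhds
    simp only [ContinuousLinearMap.comp_apply, ← map_smul, ← map_sum]
    have : ∑ i, w i q (coordMap p₀ q v) • EuclideanSpace.single i (1 : ℝ) =
        (ofComponents fun i => w i q) (coordMap p₀ q v) := by
      simp [ofComponents, sum_apply]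
    rw [this, ← he]
    simp [coordSymm_coordMap hq]
  pair i j := by
    obtain ⟨e, he⟩ := hB.self_of_nhds
    simp only [ContinuousLinearMap.comp_apply, coordMap_coordSymm hq]
    rw [← ofComponents_apply (fun i => w i q), ← he]
    simp
  smooth_coframe i := smoothCovectorAt_comp_coordMap hq (hw i)
  smooth_frame i := by
    refine smoothVectorAt_coordSymm hq ?_
    obtain ⟨e, he⟩ := hB.self_of_nhds
    have h1 : ContMDiffAt (𝓡 n) 𝓘(ℝ, Model n →L[ℝ] Model n) ∞
        (fun r => ofComponents fun i => w i r) q := by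
      have : ContMDiffAt (𝓡 n) 𝓘(ℝ, Model n →L[ℝ] Model n) ∞
        (fun r => ∑ i, (w i r).smulRight (EuclideanSpace.single i (1 : ℝ))) q := by
        exact ContMDiffAt.sum fun i _ => contMDiffAt_model_smulRight (hw i) contMDiffAt_const
      exact this
    have h2 : ContDiffAt ℝ ∞ (ContinuousLinearMap.inverse :
        (Model n →L[ℝ] Model n) → (Model n →L[ℝ] Model n)) (ofComponents fun i => w i q) := by
      rw [← he]
      exact contDiffAt_map_inverse e
    have h3 := h2.contMDiffAt.comp q h1
    exact h3.clm_apply contMDiffAt_const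

/-- A regular symbol of constant type has adapted frames near every point. -/
theorem Symbol.exists_isAdapted [T2Space M] {k : ℕ} {σ : Symbol k n M} (hreg : σ.IsRegular)
    (hconst : σ.IsConstantType) (p₀ : M) :
    ∃ (θ : Fin n → ∀ q : M, TangentSpace (𝓡 n) q →L[ℝ] ℝ)
      (F : Fin n → ∀ q : M, TangentSpace (𝓡 n) q), IsAdapted σ θ F p₀ := by
  have hfin : Module.finrank ℝ (Model n →L[ℝ] ℝ) = n := by
    rw [← (LinearMap.toContinuousLinearMap
      (E := Model n) (F' := ℝ) (𝕜 := ℝ)).finrank_eq, Module.finrank_linearMap]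
    simp
  let β : Module.Basis (Fin n) ℝ (Model n →L[ℝ] ℝ) := Module.finBasisOfFinrankEq ℝ _ hfin
  have hp₀ := mem_chart_source (Model n) p₀
  obtain ⟨ψ, C, hψ, hC, hsm, hval⟩ := exists_coframe_family hfin β _
    (hreg p₀ (coordEquiv hp₀))
  let s := σ.components p₀ β
  change LinearIndependent ℝ (fun i => ψ i (s p₀)) at hψ
  change ∀ i, ∀ᶠ x in 𝓝 (s p₀), ContDiffAt ℝ ∞ (ψ i) x at hsm
  have hsmooth := σ.contMDiffAt_components p₀ β
  have hs0 : ContinuousAt s p₀ := hsmooth.self_of_nhds.continuousAt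
  have hw : ∀ᶠ q in 𝓝 p₀, ∀ i,
      ContMDiffAt (𝓡 n) 𝓘(ℝ, Model n →L[ℝ] ℝ) ∞ (fun r => ψ i (s r)) q := by
    filter_upwards [hsmooth, hs0.eventually (eventually_all.2 hsm)] with q h1 h2 i
    exact (h2 i).contMDiffAt.comp q h1
  have hB : ∀ᶠ q in 𝓝 p₀, (ofComponents fun i => ψ i (s q)).IsInvertible := by
    have h1 : ContinuousAt (fun q => ofComponents fun i => ψ i (s q)) p₀ := by
      have : ContMDiffAt (𝓡 n) 𝓘(ℝ, Model n →L[ℝ] Model n) ∞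
        (fun r => ∑ i, (ψ i (s r)).smulRight (EuclideanSpace.single i (1 : ℝ))) p₀ :=
        ContMDiffAt.sum fun i _ =>
          contMDiffAt_model_smulRight (hw.self_of_nhds i) contMDiffAt_const
      exact this.continuousAt
    obtain ⟨e, he⟩ := isInvertible_ofComponents hψ
    have h2 := ContinuousLinearEquiv.nhds e
    rw [he] at h2
    exact h1 h2
  have hsrc : ∀ᶠ q in 𝓝 p₀, q ∈ (chartAt (Model n) p₀).source :=
    (chartAt (Model n) p₀).open_source.mem_nhds hp₀
  refine ⟨fun i r => ψ i (s r) ∘L coordMap p₀ r,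
    fun i r => coordSymm p₀ r ((ofComponents fun i => ψ i (s r)).inverse
      (EuclideanSpace.single i 1)), ?_, ?_⟩
  · filter_upwards [hsrc, hw, hB.eventually_nhds] with q h1 h2 h3
    exact isDualFrameAt_of_components h1 h2 h3
  · let c : M → (Fin k → Fin n) → ℝ :=
      fun q I => σ.toFun q (fun j => ψ (I j) (s q) ∘L coordMap p₀ q)
    -- Constant type makes `σ_q` equivalent to `σ_{p₀}`, through an isomorphism that need not depend
    -- continuously on `q`.
    have hcC : ∀ᶠ q in 𝓝 p₀, c q ∈ C := by
      filter_upwards [hsrc, hs0.eventually hval] with q h1 h2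
      obtain ⟨A, hA⟩ := hconst.exists_symm_comp h1
      have h3 := h2 A fun I => hA fun j => β (I j)
      simpa only [hA] using h3
    have hcc : ∀ᶠ q in 𝓝 p₀, ContinuousAt c q := by
      filter_upwards [hsrc.eventually_nhds, hsmooth, hw] with q h1 h2 h3
      refine continuousAt_pi.2 fun I => ?_
      have e : (fun r => c r I) =ᶠ[𝓝 q] fun r => ∑ J : Fin k → Fin n,
          s r J * ∏ j, β.repr (ψ (I j) (s r)) (J j) := by
        filter_upwards [h1] with r hr
        exact multilinear_apply_eq_sum β (pushforward (coordEquiv hr) (σ.toFun r))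
          (fun j => ψ (I j) (s r))
      refine ContinuousAt.congr ?_ e.symm
      refine tendsto_finsetSum _ fun J _ => ?_
      refine ((continuous_apply J).continuousAt.comp h2.continuousAt).mul ?_
      refine tendsto_finsetProd _ fun j _ => ?_
      exact ((β.coord (J j)).continuous_of_finiteDimensional.continuousAt).comp
        (h3 (I j)).continuousAt
    have : LocallyConnectedSpace M := ChartedSpace.locallyConnectedSpace (Model n) M
    obtain ⟨U, hU, hUo, hpU, hUc⟩ :=
      -- The image of a connected neighbourhood under `c` is connected and countable, hence a single
      -- point.
      locallyConnectedSpace_iff_subsets_isOpen_isConnected.1 this p₀ _ (hcC.and hcc)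
    filter_upwards [hUo.mem_nhds hpU] with q hq I
    have hpre : IsPreconnected (c '' U) :=
      hUc.isPreconnected.image c fun r hr => (hU hr).2.continuousWithinAt
    have hsub : (c '' U).Subsingleton :=
      hC.isTotallyDisconnected _ (by rintro _ ⟨r, hr, rfl⟩; exact (hU hr).1) hpre
    exact congrFun (hsub (Set.mem_image_of_mem c hq) (Set.mem_image_of_mem c hpU)) I

/-! ### Uniqueness, existence and flatness of the Wagner connection. -/

theorem contMDiffAt_frameDeriv {θ : Fin n → ∀ q : M, TangentSpace (𝓡 n) q →L[ℝ] ℝ}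
    {F : Fin n → ∀ q : M, TangentSpace (𝓡 n) q} {p : M} (h : IsDualFrameAt θ F p)
    {Y : ∀ q : M, TangentSpace (𝓡 n) q} (hY : SmoothVectorAt Y p) :
    ContMDiffAt (𝓡 n) ((𝓡 n).prod 𝓘(ℝ, Model n →L[ℝ] Model n)) ∞
      (fun q => TotalSpace.mk' (Model n →L[ℝ] Model n)
        (E := fun q : M => TangentSpace (𝓡 n) q →L[ℝ] TangentSpace (𝓡 n) q) q
        (frameDeriv θ F Y q)) p :=
  ContMDiffAt.sum_section (V := fun q : M => TangentSpace (𝓡 n) q →L[ℝ] TangentSpace (𝓡 n) q)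
    fun i _ => contMDiffAt_smulRight
      (smoothCovectorAt_mvfderiv ((h.smooth_coframe i).smooth_pairing hY)) (h.smooth_frame i)

theorem IsWagner.isParallelAt {k : ℕ} {σ : Symbol k n M} {D : Connection n M} (h : IsWagner σ D)
    (p : M) : IsParallelAt σ D.toFun p :=
  (isParallelAt_connection_iff σ D p).2 fun α X => h.2 α p X

theorem IsWagner.unique [T2Space M] {k : ℕ} {σ : Symbol k n M} (hσ : σ.IsRegular)
    {D D' : Connection n M} (h : IsWagner σ D) (h' : IsWagner σ D')
    {Y : ∀ q : M, TangentSpace (𝓡 n) q} {p : M} (hY : DiffAt Y p) : D.toFun Y p = D'.toFun Y p :=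
  IsParallelAt.unique hσ D.isCovariantDerivativeOn D'.isCovariantDerivativeOn
    (h.isParallelAt p) (h'.isParallelAt p) hY

theorem IsWagner.eq_frameDeriv [T2Space M] {k : ℕ} {σ : Symbol k n M} (hσ : σ.IsRegular)
    {D : Connection n M} (h : IsWagner σ D)
    {θ : Fin n → ∀ q : M, TangentSpace (𝓡 n) q →L[ℝ] ℝ}
    {F : Fin n → ∀ q : M, TangentSpace (𝓡 n) q} {p : M} (hF : IsAdapted σ θ F p)
    {Y : ∀ q : M, TangentSpace (𝓡 n) q} (hY : DiffAt Y p) : D.toFun Y p = frameDeriv θ F Y p :=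
  IsParallelAt.unique hσ D.isCovariantDerivativeOn hF.dual.self_of_nhds.isCovariantDerivativeOn
    (h.isParallelAt p) hF.isParallelAt hY

/-- A regular symbol of constant type has a Wagner connection. -/
theorem Symbol.exists_isWagner [T2Space M] {k : ℕ} {σ : Symbol k n M} (hreg : σ.IsRegular)
    (hconst : σ.IsConstantType) : ∃ D : Connection n M, IsWagner σ D := by
  choose θ F hF using fun p₀ => Symbol.exists_isAdapted hreg hconst p₀
  have hcov : ∀ p, IsCovariantDerivativeOn (Model n) (frameDeriv (θ p) (F p)) {p} := fun p =>
    (hF p).dual.self_of_nhds.isCovariantDerivativeOn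
  -- Each point uses its own adapted frame. Pointwise uniqueness identifies the result near `p₀`
  -- with the derivative of the single frame chosen at `p₀`, which gives smoothness.
  let D : Connection n M :=
    { toFun := fun Y p => frameDeriv (θ p) (F p) Y p
      isCovariantDerivativeOnUniv :=
        { add := fun hY hY' _ => (hcov _).add hY hY' rfl
          leibniz := fun hY hf _ => (hcov _).leibniz hY hf rfl } }
  refine ⟨D, ⟨fun {Y} hY p₀ _ => ?_⟩, fun α p X =>
    (isParallelAt_connection_iff σ D p).1 (hF p).isParallelAt α X⟩
  have hY' : ∀ q, SmoothVectorAt Y q := fun q =>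
    ((contMDiffOn_univ.1 hY) q).of_le le_self_add
  refine ContMDiffAt.contMDiffWithinAt ?_
  refine (contMDiffAt_frameDeriv (hF p₀).dual.self_of_nhds (hY' p₀)).congr_of_eventuallyEq ?_
  filter_upwards [(hF p₀).eventually] with q hq
  exact congrArg (TotalSpace.mk' (Model n →L[ℝ] Model n)
    (E := fun q : M => TangentSpace (𝓡 n) q →L[ℝ] TangentSpace (𝓡 n) q) q)
    (IsParallelAt.unique hreg (hcov q) hq.dual.self_of_nhds.isCovariantDerivativeOn
      (hF q).isParallelAt hq.isParallelAt (hY' q).diffAt)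

/-- The Wagner connection of a regular symbol of constant type is flat. -/
theorem IsWagner.curvature_eq_zero [T2Space M] [NeZero n] {k : ℕ} {σ : Symbol k n M}
    (hreg : σ.IsRegular) (hconst : σ.IsConstantType) {D : Connection n M} (hD : IsWagner σ D)
    {X Y Z : ∀ q : M, TangentSpace (𝓡 n) q} (hX : SmoothField X) (hY : SmoothField Y)
    (hZ : SmoothField Z) (p : M) : curvature D X Y Z p = 0 := by
  obtain ⟨θ, F, hF⟩ := Symbol.exists_isAdapted hreg hconst p
  have hz : ∀ i, ∀ᶠ q in 𝓝 p, ContMDiffAt (𝓡 n) 𝓘(ℝ, ℝ) ∞ (fun q => θ i q (Z q)) q := by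
    intro i
    filter_upwards [hF.dual] with q hq
    exact (hq.smooth_coframe i).smooth_pairing (hZ q)
  -- In an adapted frame `θ_i(∇_V Z) = V(θ_i(Z))` near `p`, so second covariant derivatives are
  -- iterated derivatives of the coefficients `θ_i(Z)`.
  have key : ∀ V : ∀ q : M, TangentSpace (𝓡 n) q, SmoothField V →
      DiffAt (fun q => D.toFun Z q (V q)) p ∧ ∀ i, mvfderiv (𝓡 n)
        (fun q => θ i q (D.toFun Z q (V q))) p =
          mvfderiv (𝓡 n) (fun q => mvfderiv (𝓡 n) (fun r => θ i r (Z r)) q (V q)) p := by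
    intro V hV
    have hev : ∀ᶠ q in 𝓝 p, D.toFun Z q = frameDeriv θ F Z q := by
      filter_upwards [hF.eventually] with q hq
      exact hD.eq_frameDeriv hreg hq (SmoothVectorAt.diffAt (hZ q))
    constructor
    · have h1 : SmoothVectorAt (fun q => frameDeriv θ F Z q (V q)) p :=
        ContMDiffAt.clm_bundle_apply (contMDiffAt_frameDeriv hF.dual.self_of_nhds (hZ p)) (hV p)
      refine SmoothVectorAt.diffAt (h1.congr_of_eventuallyEq ?_)
      filter_upwards [hev] with q hq
      rw [hq]
    · intro i
      refine mvfderiv_congr ?_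
      filter_upwards [hev, hF.dual] with q hq hd
      rw [hq, frameDeriv_apply, map_sum]
      simp [hd.pair]
  rw [curvature, hD.eq_frameDeriv hreg hF (key Y hY).1, hD.eq_frameDeriv hreg hF (key X hX).1,
    hD.eq_frameDeriv hreg hF (SmoothVectorAt.diffAt (hZ p))]
  simp only [frameDeriv_apply, (key Y hY).2, (key X hX).2]
  rw [← Finset.sum_sub_distrib, ← Finset.sum_sub_distrib]
  refine Finset.sum_eq_zero fun i _ => ?_
  rw [mvfderiv_mlieBracket (hX p) (hY p) (hz i)]
  module

end Manifold

end WagnerConnection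

theorem mainTheorem6 {k n : ℕ} (hk : 3 ≤ k) (hn : 2 ≤ n)
    {M : Type*} [TopologicalSpace M] [ChartedSpace (WagnerConnection.Model n) M]
    [IsManifold (𝓡 n) ∞ M] [T2Space M]
    (σ : WagnerConnection.Symbol k n M) (hreg : σ.IsRegular) (hconst : σ.IsConstantType) :
    (∃ D : WagnerConnection.Connection n M, WagnerConnection.IsWagner σ D) ∧
    (∀ D D' : WagnerConnection.Connection n M,
      WagnerConnection.IsWagner σ D → WagnerConnection.IsWagner σ D' →
      ∀ (Y : ∀ p : M, TangentSpace (𝓡 n) p) (p : M),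
        WagnerConnection.DiffAt Y p → D.toFun Y p = D'.toFun Y p) ∧
    (∀ D : WagnerConnection.Connection n M, WagnerConnection.IsWagner σ D →
      ∀ X Y Z : (∀ p : M, TangentSpace (𝓡 n) p),
        WagnerConnection.SmoothField X → WagnerConnection.SmoothField Y →
        WagnerConnection.SmoothField Z →
        ∀ p : M, WagnerConnection.curvature D X Y Z p = 0) := by
  have : NeZero n := ⟨by omega⟩
  exact ⟨WagnerConnection.Symbol.exists_isWagner hreg hconst,
    fun D D' h h' Y p hY => h.unique hreg h' hY,
    fun D h X Y Z hX hY hZ p => h.curvature_eq_zero hreg hconst hX hY hZ p⟩
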